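/- Let $\mathbf{G}_n$ be one of the families $\mathrm{GL}_n$, $\mathrm{SL}_n$, $\mathrm{Sp}_{2n}$, $\mathrm{SO}_{n,n}$, $\mathrm{SO}_{n,n+1}$, let $k$ be a field and let $R$ be a commutative ring. Here $\mathrm{Sp}_{2n}(k)$ preserves the standard symplectic form on $V_n=k^{2n}$ with basis $a_1,\dots,a_n,b_1,\dots,b_n$, and $\mathrm{SO}_{n,n}(k)$, $\mathrm{SO}_{n,n+1}(k)$ are the groups of determinant-one matrices preserving $q=\sum_j c_jd_j$ on $V_n=k^{2n}$ (basis $a_j,b_j$, coordinates $c_j,d_j$), respectively $q=\lambda^2+\sum_j c_jd_j$ on $V_n=k^{2n+1}$ (basis $a_j,b_j,e$, with $\lambda$ the coordinate of $e$), in every characteristic. For $\mathrm{GL}_n$ and $\mathrm{SL}_n$ put $V_n=k^n$ with basis $a_1,\dots,a_n$. Let $\mathcal T_n$ be the Tits building, whose simplices are the flags of nonzero proper subspaces of $V_n$ (for $\mathrm{GL}_n,\mathrm{SL}_n$), respectively of nonzero isotropic subspaces of $V_n$ (in the other cases; for quadratic forms, isotropic means that $q$ vanishes identically on the subspace). Put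 $r=\max(n-1,0)$ for $\mathrm{GL}_n,\mathrm{SL}_n$ and $r=n$ otherwise, so that $\dim\mathcal T_n=r-1$, and let $\mathrm{St}_{\mathbf G_n}(k;R)=\widetilde H_{r-1}(\mathcal T_n;R)$, where $\widetilde H_{-1}(\emptyset;R)=R$. For $n\ge 2$ embed $\mathbf G_{n-1}(k)$ in $\mathbf G_n(k)$ as the subgroup acting on the span $W$ of all standard basis vectors of $V_n$ other than $a_1$ (and other than $b_1$ in the symplectic and orthogonal cases), where $V_{n-1}$ is identified with $W$ by $a_j\mapsto a_{j+1}$, $b_j\mapsto b_{j+1}$, $e\mapsto e$, and fixing $a_1$ (and $b_1$). The Reeder product map with the generator of $\mathrm{St}_{\mathrm{GL}_1}(k;R)=R$ is the $\mathbf G_{n-1}(k)$-equivariant map $\mathrm{St}_{\mathbf G_{n-1}}(k;R)\to\mathrm{St}_{\mathbf G_n}(k;R)$ induced by the following map on chains. For a line $p$ and a flag $U_1\subsetneq\cdots\subsetneq U_d$ in $W$ (with $U_0=0$) put $$s_p(U_1,\dots,U_d)=\sum_{j=0}^{d}(-1)^j\,(U_1,\dots,U_j,U_j+p,U_{j+1}+p,\dots,U_d+p).$$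 The map sends $(U_1,\dots,U_d)$ to $s_{\langle a_1\rangle}(U_1,\dots,U_d)-(-1)^d(U_1,\dots,U_d,W)$ for $\mathrm{GL}_n$ and $\mathrm{SL}_n$, and to $s_{\langle a_1\rangle}(U_1,\dots,U_d)-s_{\langle b_1\rangle}(U_1,\dots,U_d)$ in the other cases. Together these maps induce, for all $i\ge 0$ and $n\ge2$, the stabilization map $$H_i(\mathbf G_{n-1}(k);\mathrm{St}_{\mathbf G_{n-1}}(k;R))\longrightarrow H_i(\mathbf G_n(k);\mathrm{St}_{\mathbf G_n}(k;R)).$$ **Lemma.** Fix $i\ge 0$ and $N\ge 2$. Suppose that the stabilization map is surjective for all $n\ge N$. Then $H_i(\mathbf G_n(k);\mathrm{St}_{\mathbf G_n}(k;R))=0$ for all $n\ge N+1$. -/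

import Mathlib

universe u v

/-! ## Reduced simplicial homology of order complexes -/

namespace OrderComplex

noncomputable section

variable {α β : Type*} (R : Type*) [CommRing R]

/-- The alternating sum of the faces of an ordered simplex, written as the list of its vertices.
The one-vertex simplex `[x]` has boundary the empty simplex `[]` (this is the augmentation). -/
def faces (l : List α) : List α →₀ R :=
  ∑ i ∈ Finset.range l.length, (-1 : R) ^ i • Finsupp.single (l.eraseIdx i) (1 : R)

/-- The augmented simplicial boundary operator, on formal combinations of vertex lists. -/
def boundary : (List α →₀ R) →ₗ[R] (List α →₀ R) :=
  Finsupp.linearCombination R (faces R)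

/-- The `R`-module of simplicial chains of the order complex of a subset `X` of a partially ordered
type, spanned by the simplices with exactly `d` vertices, i.e. the strictly increasing chains
`x_1 < ⋯ < x_d` in `X`; thus `d` is one more than the usual simplicial dimension, and `d = 0` is the
augmentation module `R`, spanned by the empty simplex. -/
def chains [Preorder α] (X : Set α) (d : ℕ) : Submodule R (List α →₀ R) :=
  Finsupp.supported R R {l : List α | l.Pairwise (· < ·) ∧ (∀ x ∈ l, x ∈ X) ∧ l.length = d}

/-- Cycles among the chains on simplices with `d` vertices. -/
def cycles [Preorder α] (X : Set α) (d : ℕ) : Submodule R (List α →₀ R) :=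
  chains R X d ⊓ LinearMap.ker (boundary R)

/-- Boundaries among the chains on simplices with `d` vertices. -/
def boundaries [Preorder α] (X : Set α) (d : ℕ) : Submodule R (List α →₀ R) :=
  (chains R X (d + 1)).map (boundary R)

/-- The reduced simplicial homology `H̃_{d-1}(Δ(X); R) = cycles / boundaries` of the order complex
of `X`, realized as the image of the module of cycles in the quotient of the module of all chains by
the boundaries. For empty `X` this gives `H̃_{-1}(∅; R) = R`. -/
abbrev RedHomology {α : Type u} (R : Type v) [CommRing R] [Preorder α] (X : Set α) (d : ℕ) :
    Type (max u v) :=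
  (cycles R X d).map (boundaries R X d).mkQ

/-- The map of chains induced by a map of vertices. -/
def vertexMap (f : α → β) : (List α →₀ R) →ₗ[R] (List β →₀ R) :=
  Finsupp.lmapDomain R R (List.map f)

/-- Putting a new first vertex in front of every simplex. -/
def consMap (x : α) : (List α →₀ R) →ₗ[R] (List α →₀ R) :=
  Finsupp.lmapDomain R R (List.cons x)

@[simp] lemma boundary_single (l : List α) :
    boundary R (Finsupp.single l 1) = faces R l := by
  simp [boundary]

@[simp] lemma vertexMap_single (f : α → β) (l : List α) (r : R) :
    vertexMap R f (Finsupp.single l r) = Finsupp.single (l.map f) r := by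
  simp [vertexMap]

@[simp] lemma consMap_single (x : α) (l : List α) (r : R) :
    consMap R x (Finsupp.single l r) = Finsupp.single (x :: l) r := by
  simp [consMap]

@[simp] lemma faces_nil : faces R ([] : List α) = 0 := by simp [faces]

lemma faces_cons (x : α) (l : List α) :
    faces R (x :: l) = Finsupp.single l 1 - consMap R x (faces R l) := by
  simp only [faces, List.length_cons, Finset.sum_range_succ', map_sum, map_smul, consMap_single]
  simp [pow_succ, sub_eq_add_neg, add_comm]

lemma boundary_consMap (x : α) (z : List α →₀ R) :
    boundary R (consMap R x z) = z - consMap R x (boundary R z) := by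
  induction z using Finsupp.induction_linear with
  | zero => simp
  | add a b ha hb => simp only [map_add, ha, hb]; abel
  | single l r =>
    have h : (Finsupp.single l r : List α →₀ R) = r • Finsupp.single l 1 := by simp
    rw [h]
    simp only [map_smul, consMap_single, boundary_single, faces_cons, smul_sub]

lemma boundary_vertexMap (f : α → β) (z : List α →₀ R) :
    boundary R (vertexMap R f z) = vertexMap R f (boundary R z) := by
  induction z using Finsupp.induction_linear with
  | zero => simp
  | add a b ha hb => simp only [map_add, ha, hb]
  | single l r =>
    have h : (Finsupp.single l r : List α →₀ R) = r • Finsupp.single l 1 := by simp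
    rw [h]
    simp only [map_smul, vertexMap_single, boundary_single]
    congr 1
    simp only [faces, map_sum, map_smul, vertexMap_single, List.length_map, List.eraseIdx_map]

/-- A linear map on chains that sends simplices with `d` vertices to chains with `e` vertices
(and `d + 1` to `e + 1`) and commutes with the boundary up to a sign induces a map on homology. -/
def RedHomology.map [Preorder α] [Preorder β] {X : Set α} {Y : Set β} {d e : ℕ}
    (T : (List α →₀ R) →ₗ[R] (List β →₀ R)) (c : R) (hc : c * c = 1)
    (hT : ∀ z, boundary R (T z) = c • T (boundary R z))
    (h0 : ∀ z ∈ chains R X d, T z ∈ chains R Y e)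
    (h1 : ∀ z ∈ chains R X (d + 1), T z ∈ chains R Y (e + 1)) :
    RedHomology R X d →ₗ[R] RedHomology R Y e :=
  ((boundaries R X d).mapQ (boundaries R Y e) T (by
      rintro _ ⟨y, hy, rfl⟩
      refine ⟨c • T y, Submodule.smul_mem _ _ (h1 y hy), ?_⟩
      rw [map_smul, hT, smul_smul, hc, one_smul])).restrict (by
    rintro _ ⟨z, ⟨hz, hz'⟩, rfl⟩
    refine ⟨T z, ⟨h0 z hz, ?_⟩, rfl⟩
    have hz'' : boundary R z = 0 := hz'
    change boundary R (T z) = 0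
    rw [hT, hz'', map_zero, smul_zero])

lemma RedHomology.map_mk [Preorder α] [Preorder β] {X : Set α} {Y : Set β} {d e : ℕ}
    (T : (List α →₀ R) →ₗ[R] (List β →₀ R)) (c : R) (hc : c * c = 1)
    (hT : ∀ z, boundary R (T z) = c • T (boundary R z))
    (h0 : ∀ z ∈ chains R X d, T z ∈ chains R Y e)
    (h1 : ∀ z ∈ chains R X (d + 1), T z ∈ chains R Y (e + 1))
    (z : List α →₀ R) (hz : (boundaries R X d).mkQ z ∈ (cycles R X d).map (boundaries R X d).mkQ) :
    (RedHomology.map R T c hc hT h0 h1 ⟨(boundaries R X d).mkQ z, hz⟩ :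
      (List β →₀ R) ⧸ boundaries R Y e) = (boundaries R Y e).mkQ (T z) := rfl

lemma chains_le_of_single [Preorder α] [Preorder β] {X : Set α} {Y : Set β} {d e : ℕ}
    (T : (List α →₀ R) →ₗ[R] (List β →₀ R))
    (h : ∀ l : List α, l.Pairwise (· < ·) → (∀ x ∈ l, x ∈ X) → l.length = d →
      T (Finsupp.single l 1) ∈ chains R Y e) :
    ∀ z ∈ chains R X d, T z ∈ chains R Y e := by
  intro z hz
  have : chains R X d ≤ (chains R Y e).comap T := by
    rw [chains, Finsupp.supported_eq_span_single, Submodule.span_le]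
    rintro _ ⟨l, ⟨h1, h2, h3⟩, rfl⟩
    exact h l h1 h2 h3
  exact this hz

lemma single_mem_chains [Preorder α] {X : Set α} {d : ℕ} {l : List α}
    (h1 : l.Pairwise (· < ·)) (h2 : ∀ x ∈ l, x ∈ X) (h3 : l.length = d) (r : R) :
    Finsupp.single l r ∈ chains R X d :=
  Finsupp.single_mem_supported R r ⟨h1, h2, h3⟩

lemma vertexMap_mem_chains [Preorder α] [Preorder β] {X : Set α} {Y : Set β} (f : α → β)
    (hf : StrictMono f) (hXY : ∀ x ∈ X, f x ∈ Y) (d : ℕ) :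
    ∀ z ∈ chains R X d, vertexMap R f z ∈ chains R Y d := by
  apply chains_le_of_single
  intro l h1 h2 h3
  rw [vertexMap_single]
  refine single_mem_chains R ?_ ?_ (by simpa using h3) 1
  · exact List.pairwise_map.2 (h1.imp fun h => hf h)
  · intro y hy
    obtain ⟨x, hx, rfl⟩ := List.mem_map.1 hy
    exact hXY x (h2 x hx)

/-- The map on reduced homology of order complexes induced by a strictly increasing map. -/
def RedHomology.vertexMap [Preorder α] [Preorder β] {X : Set α} {Y : Set β} (f : α → β)
    (hf : StrictMono f) (hXY : ∀ x ∈ X, f x ∈ Y) (d : ℕ) :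
    RedHomology R X d →ₗ[R] RedHomology R Y d :=
  RedHomology.map R (OrderComplex.vertexMap R f) 1 (one_mul 1)
    (fun z => by rw [one_smul, boundary_vertexMap])
    (vertexMap_mem_chains R f hf hXY d) (vertexMap_mem_chains R f hf hXY (d + 1))

/-- The first pole of the suspension. In a lattice, a chain `x_1 < ⋯ < x_d` is sent to
`∑_{j=0}^{d} (-1)^j (x_1 < ⋯ < x_j < x_j ⊔ p < ⋯ < x_d ⊔ p)`, where `x_0 = b` is the bottom
element. -/
def poleFaces [Max α] (p b : α) (l : List α) : List α →₀ R :=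
  ∑ j ∈ Finset.range (l.length + 1),
    (-1 : R) ^ j • Finsupp.single (l.take j ++ ((b :: l).drop j).map (· ⊔ p)) (1 : R)

/-- The linear extension of `poleFaces`. -/
def pole [Max α] (p b : α) : (List α →₀ R) →ₗ[R] (List α →₀ R) :=
  Finsupp.linearCombination R (poleFaces R p b)

/-- The cone with a top vertex: a chain `x_1 < ⋯ < x_d` is sent to
`(-1)^d (x_1 < ⋯ < x_d < w)`. -/
def topPole (w : α) : (List α →₀ R) →ₗ[R] (List α →₀ R) :=
  Finsupp.linearCombination R fun l =>
    (-1 : R) ^ l.length • Finsupp.single (l ++ [w]) (1 : R)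

@[simp] lemma pole_single [Max α] (p b : α) (l : List α) :
    pole R p b (Finsupp.single l 1) = poleFaces R p b l := by
  simp [pole]

@[simp] lemma topPole_single (w : α) (l : List α) :
    topPole R w (Finsupp.single l 1) = (-1 : R) ^ l.length • Finsupp.single (l ++ [w]) (1 : R) := by
  simp [topPole]

lemma poleFaces_nil [Max α] (p b : α) :
    poleFaces R p b [] = Finsupp.single [b ⊔ p] 1 := by
  simp [poleFaces]

lemma poleFaces_cons [Max α] (p b x : α) (l : List α) :
    poleFaces R p b (x :: l) =
      Finsupp.single ((b ⊔ p) :: (x :: l).map (· ⊔ p)) 1 - consMap R x (poleFaces R p x l) := by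
  unfold poleFaces
  rw [List.length_cons, Finset.sum_range_succ']
  simp only [map_sum, map_smul, consMap_single]
  simp [pow_succ, sub_eq_add_neg, add_comm]

lemma pole_consMap [Max α] (p b x : α) (z : List α →₀ R) :
    pole R p b (consMap R x z) =
      consMap R (b ⊔ p) (consMap R (x ⊔ p) (vertexMap R (· ⊔ p) z)) -
        consMap R x (pole R p x z) := by
  induction z using Finsupp.induction_linear with
  | zero => simp
  | add a b ha hb => simp only [map_add, ha, hb]; abel
  | single l r =>
    have h : (Finsupp.single l r : List α →₀ R) = r • Finsupp.single l 1 := by simp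
    rw [h]
    simp only [map_smul, consMap_single, pole_single, poleFaces_cons, vertexMap_single, smul_sub,
      List.map_cons]

lemma pole_base [Max α] (p b b' : α) (l : List α) :
    Finsupp.single ((b ⊔ p) :: l.map (· ⊔ p)) (1 : R) - poleFaces R p b l =
      Finsupp.single ((b' ⊔ p) :: l.map (· ⊔ p)) (1 : R) - poleFaces R p b' l := by
  cases l with
  | nil => simp [poleFaces_nil]
  | cons x l => simp [poleFaces_cons]

lemma boundary_pole_single [Max α] (p b : α) (l : List α) :
    boundary R (poleFaces R p b l) = Finsupp.single l 1 - pole R p b (faces R l) := by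
  induction l generalizing b with
  | nil => simp [poleFaces_nil, faces_cons]
  | cons x l ih =>
    have key := pole_base R p x b l
    have hm : vertexMap R (· ⊔ p) (faces R l) = faces R (l.map (· ⊔ p)) := by
      rw [← boundary_single, ← boundary_vertexMap, vertexMap_single, boundary_single]
    rw [poleFaces_cons, map_sub, boundary_single, boundary_consMap, ih, List.map_cons, faces_cons,
      faces_cons, faces_cons]
    simp only [map_sub, pole_consMap, pole_single, consMap_single, hm]
    rw [sub_eq_sub_iff_add_eq_add] at key
    have key' : Finsupp.single ((x ⊔ p) :: l.map (· ⊔ p)) (1 : R) =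
      Finsupp.single ((b ⊔ p) :: l.map (· ⊔ p)) (1 : R) + poleFaces R p x l
        - poleFaces R p b l := by
      rw [← key]; abel
    rw [key']
    abel

lemma boundary_pole [Max α] (p b : α) (z : List α →₀ R) :
    boundary R (pole R p b z) = z - pole R p b (boundary R z) := by
  induction z using Finsupp.induction_linear with
  | zero => simp
  | add a b ha hb => simp only [map_add, ha, hb]; abel
  | single l r =>
    have h : (Finsupp.single l r : List α →₀ R) = r • Finsupp.single l 1 := by simp
    rw [h]
    simp only [map_smul, pole_single, boundary_single, boundary_pole_single, smul_sub]

lemma topPole_consMap (w x : α) (z : List α →₀ R) :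
    topPole R w (consMap R x z) = - consMap R x (topPole R w z) := by
  induction z using Finsupp.induction_linear with
  | zero => simp
  | add a b ha hb => simp only [map_add, ha, hb]; abel
  | single l r =>
    have h : (Finsupp.single l r : List α →₀ R) = r • Finsupp.single l 1 := by simp
    rw [h]
    simp only [map_smul, consMap_single, topPole_single, List.length_cons, List.cons_append,
      pow_succ, mul_neg, mul_one, neg_smul, smul_neg]

lemma boundary_topPole (w : α) (z : List α →₀ R) :
    boundary R (topPole R w z) = z - topPole R w (boundary R z) := by
  induction z using Finsupp.induction_linear with
  | zero => simp
  | add a b ha hb => simp only [map_add, ha, hb]; abel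
  | single l r =>
    have h : (Finsupp.single l r : List α →₀ R) = r • Finsupp.single l 1 := by simp
    rw [h, map_smul, map_smul, map_smul, map_smul, ← smul_sub]
    congr 1
    induction l with
    | nil => simp [faces_cons]
    | cons x l ih =>
      have hx : (Finsupp.single (x :: l) 1 : List α →₀ R) = consMap R x (Finsupp.single l 1) := by
        simp
      rw [hx, topPole_consMap, map_neg, boundary_consMap, ih (by simp), boundary_consMap]
      simp only [map_sub, topPole_consMap]
      abel

lemma vertexMap_pole [Max α] [Max β] (f : α → β) (hf : ∀ x y, f (x ⊔ y) = f x ⊔ f y) (p b : α)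
    (z : List α →₀ R) :
    vertexMap R f (pole R p b z) = pole R (f p) (f b) (vertexMap R f z) := by
  induction z using Finsupp.induction_linear with
  | zero => simp
  | add a b ha hb => simp only [map_add, ha, hb]
  | single l r =>
    have h : (Finsupp.single l r : List α →₀ R) = r • Finsupp.single l 1 := by simp
    have hcomp : f ∘ (· ⊔ p) = (· ⊔ f p) ∘ f := by
      funext x
      exact hf x p
    rw [h]
    simp only [map_smul, pole_single, vertexMap_single]
    congr 1
    simp only [poleFaces, map_sum, map_smul, vertexMap_single, List.length_map, List.map_append,
      List.map_take, List.map_map, hcomp]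
    simp only [← List.map_map, List.map_drop, List.map_cons, Function.comp_apply]

lemma vertexMap_topPole (f : α → β) (w : α) (z : List α →₀ R) :
    vertexMap R f (topPole R w z) = topPole R (f w) (vertexMap R f z) := by
  induction z using Finsupp.induction_linear with
  | zero => simp
  | add a b ha hb => simp only [map_add, ha, hb]
  | single l r =>
    have h : (Finsupp.single l r : List α →₀ R) = r • Finsupp.single l 1 := by simp
    rw [h]
    simp only [map_smul, topPole_single, vertexMap_single, List.length_map, List.map_append,
      List.map_cons, List.map_nil]

lemma topPole_single_mem [Preorder α] {Y : Set α} {w : α} (hw : w ∈ Y) {l : List α}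
    (h1 : l.Pairwise (· < ·)) (h2 : ∀ x ∈ l, x ∈ Y ∧ x < w) :
    topPole R w (Finsupp.single l 1) ∈ chains R Y (l.length + 1) := by
  rw [topPole_single]
  refine Submodule.smul_mem _ _ (single_mem_chains R ?_ ?_ (by simp) 1)
  · rw [List.pairwise_append]
    refine ⟨h1, List.pairwise_singleton _ _, ?_⟩
    intro x hx y hy
    rw [List.mem_singleton.1 hy]
    exact (h2 x hx).2
  · intro x hx
    rcases List.mem_append.1 hx with hx | hx
    · exact (h2 x hx).1
    · rw [List.mem_singleton.1 hx]; exact hw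

lemma consMap_mem [Preorder α] {Y : Set α} {b x : α} (hx : x ∈ Y) (hbx : b < x) {d : ℕ} :
    ∀ z ∈ chains R (Y ∩ Set.Ioi x) d, consMap R x z ∈ chains R (Y ∩ Set.Ioi b) (d + 1) := by
  apply chains_le_of_single
  intro l h1 h2 h3
  rw [consMap_single]
  refine single_mem_chains R ?_ ?_ (by simp [h3]) 1
  · exact List.pairwise_cons.2 ⟨fun y hy => (h2 y hy).2, h1⟩
  · intro y hy
    rcases List.mem_cons.1 hy with rfl | hy
    · exact ⟨hx, hbx⟩
    · exact ⟨(h2 y hy).1, hbx.trans (h2 y hy).2⟩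

lemma sup_lt_sup_of_disjoint [Lattice α] [IsModularLattice α] [OrderBot α] {p x y : α}
    (hxy : x < y) (hy : Disjoint y p) : x ⊔ p < y ⊔ p := by
  refine lt_of_le_of_ne (sup_le_sup_right hxy.le p) fun h => hxy.ne ?_
  exact eq_of_le_of_inf_le_of_sup_le hxy.le (hy.eq_bot.le.trans bot_le) h.ge

lemma lt_sup_of_disjoint [Lattice α] [OrderBot α] {p x : α} (hp : p ≠ ⊥) (hx : Disjoint x p) :
    x < x ⊔ p := by
  refine lt_of_le_of_ne le_sup_left fun h => hp ?_
  have hpx : p ≤ x := by rw [h]; exact le_sup_right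
  exact hx.eq_bot_of_ge hpx

lemma poleFaces_mem [Lattice α] [IsModularLattice α] [OrderBot α] {Y : Set α} {p : α}
    (hp : p ≠ ⊥) (l : List α) (b : α) (h1 : (b :: l).Pairwise (· < ·))
    (h2 : ∀ x ∈ b :: l, Disjoint x p ∧ x ⊔ p ∈ Y) (h3 : ∀ x ∈ l, x ∈ Y) :
    poleFaces R p b l ∈ chains R (Y ∩ Set.Ioi b) (l.length + 1) := by
  have hmem : Finsupp.single ((b :: l).map (· ⊔ p)) (1 : R) ∈
      chains R (Y ∩ Set.Ioi b) (l.length + 1) := by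
    refine single_mem_chains R ?_ ?_ (by simp) 1
    · rw [List.pairwise_map]
      exact h1.imp_of_mem fun _ hy hxy => sup_lt_sup_of_disjoint hxy (h2 _ hy).1
    · intro y hy
      obtain ⟨x, hx, rfl⟩ := List.mem_map.1 hy
      refine ⟨(h2 x hx).2, ?_⟩
      rcases List.mem_cons.1 hx with rfl | hx'
      · exact lt_sup_of_disjoint hp (h2 _ hx).1
      · exact lt_of_lt_of_le ((List.pairwise_cons.1 h1).1 x hx') le_sup_left
  induction l generalizing b with
  | nil => rw [poleFaces_nil]; exact hmem
  | cons x l ih =>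
    rw [poleFaces_cons]
    refine Submodule.sub_mem _ hmem ?_
    have h1' := (List.pairwise_cons.1 h1).2
    refine consMap_mem R (h3 x (by simp)) ((List.pairwise_cons.1 h1).1 x (by simp)) _
      (ih x h1' (fun y hy => h2 y (List.mem_cons_of_mem _ hy))
        (fun y hy => h3 y (List.mem_cons_of_mem _ hy)) ?_)
    refine single_mem_chains R ?_ ?_ (by simp) 1
    · rw [List.pairwise_map]
      exact h1'.imp_of_mem fun _ hy hxy =>
        sup_lt_sup_of_disjoint hxy (h2 _ (List.mem_cons_of_mem _ hy)).1
    · intro y hy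
      obtain ⟨u, hu, rfl⟩ := List.mem_map.1 hy
      refine ⟨(h2 u (List.mem_cons_of_mem _ hu)).2, ?_⟩
      rcases List.mem_cons.1 hu with rfl | hu'
      · exact lt_sup_of_disjoint hp (h2 _ (List.mem_cons_of_mem _ hu)).1
      · exact lt_of_lt_of_le ((List.pairwise_cons.1 h1').1 u hu') le_sup_left

lemma pole_single_mem [Lattice α] [IsModularLattice α] [OrderBot α] {Y : Set α} {p : α}
    (hp : p ≠ ⊥) (hpY : p ∈ Y) {l : List α} (h1 : l.Pairwise (· < ·))
    (h2 : ∀ x ∈ l, x ≠ ⊥ ∧ x ∈ Y ∧ Disjoint x p ∧ x ⊔ p ∈ Y) :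
    pole R p ⊥ (Finsupp.single l 1) ∈ chains R Y (l.length + 1) := by
  rw [pole_single]
  refine Finsupp.supported_mono ?_ (poleFaces_mem R (Y := Y) hp l ⊥ ?_ ?_ fun x hx => (h2 x hx).2.1)
  · rintro m ⟨hm1, hm2, hm3⟩
    exact ⟨hm1, fun x hx => (hm2 x hx).1, hm3⟩
  · exact List.pairwise_cons.2 ⟨fun x hx => bot_lt_iff_ne_bot.2 (h2 x hx).1, h1⟩
  · intro x hx
    rcases List.mem_cons.1 hx with rfl | hx
    · exact ⟨disjoint_bot_left, by rwa [bot_sup_eq]⟩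
    · exact (h2 x hx).2.2

end

end OrderComplex

/-! ## The classical groups and their Steinberg representations -/

/-- The families `GL_n`, `SL_n`, `Sp_{2n}`, `SO_{n,n}` and `SO_{n,n+1}`. -/
inductive ClassicalFamily
  | gl
  | sl
  | sp
  | soEven
  | soOdd

namespace ClassicalFamily

noncomputable section

open OrderComplex

/-- The index set of the standard basis of the standard representation: `a_1, …, a_n` for `GL_n` and
`SL_n`; `a_1, …, a_n, b_1, …, b_n` for `Sp_{2n}` and `SO_{n,n}`; and
`a_1, …, a_n, b_1, …, b_n, e` for `SO_{n,n+1}`. -/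
abbrev Idx : ClassicalFamily → ℕ → Type
  | gl, n => Fin n
  | sl, n => Fin n
  | sp, n => Fin n ⊕ Fin n
  | soEven, n => Fin n ⊕ Fin n
  | soOdd, n => (Fin n ⊕ Fin n) ⊕ Unit

instance (c : ClassicalFamily) (n : ℕ) : DecidableEq (c.Idx n) := by
  cases c <;> dsimp only [Idx] <;> infer_instance

instance (c : ClassicalFamily) (n : ℕ) : Fintype (c.Idx n) := by
  cases c <;> dsimp only [Idx] <;> infer_instance

/-- The standard representation. -/
abbrev Vec (c : ClassicalFamily) (n : ℕ) (F : Type u) : Type u := c.Idx n → F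

variable {F : Type u} [Field F]

/-- The standard symplectic form on `F^{2n}`. -/
def symplecticForm (n : ℕ) (v w : Fin n ⊕ Fin n → F) : F :=
  ∑ j, (v (.inl j) * w (.inr j) - v (.inr j) * w (.inl j))

/-- The quadratic form `∑ c_j d_j` on `F^{2n}`. -/
def quadEven (n : ℕ) (v : Fin n ⊕ Fin n → F) : F :=
  ∑ j, v (.inl j) * v (.inr j)

/-- The quadratic form `λ ^ 2 + ∑ c_j d_j` on `F^{2n+1}`. -/
def quadOdd (n : ℕ) (v : (Fin n ⊕ Fin n) ⊕ Unit → F) : F :=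
  v (.inr ()) ^ 2 + ∑ j, v (.inl (.inl j)) * v (.inl (.inr j))

/-- The subgroup of linear automorphisms that preserve a function of two vectors. -/
def preservingForm {V : Type*} [AddCommGroup V] [Module F V] (ω : V → V → F) :
    Subgroup (V ≃ₗ[F] V) where
  carrier := {g | ∀ v w, ω (g v) (g w) = ω v w}
  one_mem' _ _ := rfl
  mul_mem' {g h} hg hh v w := by
    change ω (g (h v)) (g (h w)) = ω v w
    rw [hg, hh]
  inv_mem' {g} hg v w := by
    have := hg (g⁻¹ v) (g⁻¹ w)
    rw [← this]
    exact congrArg₂ ω (g.apply_symm_apply v).symm (g.apply_symm_apply w).symm |>.symm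

/-- The subgroup of linear automorphisms that preserve a function of one vector. -/
def preservingQuad {V : Type*} [AddCommGroup V] [Module F V] (q : V → F) :
    Subgroup (V ≃ₗ[F] V) where
  carrier := {g | ∀ v, q (g v) = q v}
  one_mem' _ := rfl
  mul_mem' {g h} hg hh v := by
    change q (g (h v)) = q v
    rw [hg, hh]
  inv_mem' {g} hg v := by
    have := hg (g⁻¹ v)
    rw [← this]
    exact congrArg q (g.apply_symm_apply v)

variable (F) in
/-- The group `G_n(F)`, as a group of linear automorphisms of the standard representation. -/
def group : (c : ClassicalFamily) → (n : ℕ) → Subgroup (c.Vec n F ≃ₗ[F] c.Vec n F)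
  | gl, _ => ⊤
  | sl, _ => LinearEquiv.det.ker
  | sp, n => preservingForm (symplecticForm n)
  | soEven, n => LinearEquiv.det.ker ⊓ preservingQuad (quadEven n)
  | soOdd, n => LinearEquiv.det.ker ⊓ preservingQuad (quadOdd n)

variable (F) in
/-- The subspaces that are the vertices of the Tits building: the nonzero proper subspaces for `GL_n`
and `SL_n`, and the nonzero isotropic subspaces in the other cases. The simplices of the building are
the flags of such subspaces. (For `SO_{n,n}` an isotropic subspace of dimension `n - 1` lies in exactly
two maximal ones, so this flag complex is the subdivision of the building of type `D_n` whose new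
vertices are the midpoints of the edges joining such pairs; for `n = 1` it consists of two points, and
its reduced homology is `R` in degree `0`.) -/
def vertices : (c : ClassicalFamily) → (n : ℕ) → Set (Submodule F (c.Vec n F))
  | gl, _ => {U | U ≠ ⊥ ∧ U ≠ ⊤}
  | sl, _ => {U | U ≠ ⊥ ∧ U ≠ ⊤}
  | sp, n => {U | U ≠ ⊥ ∧ ∀ v ∈ U, ∀ w ∈ U, symplecticForm n v w = 0}
  | soEven, n => {U | U ≠ ⊥ ∧ ∀ v ∈ U, quadEven n v = 0}
  | soOdd, n => {U | U ≠ ⊥ ∧ ∀ v ∈ U, quadOdd n v = 0}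

/-- The maximal number of subspaces in a flag; the building has dimension `rank - 1`. -/
def rank : ClassicalFamily → ℕ → ℕ
  | gl, n => n - 1
  | sl, n => n - 1
  | sp, n => n
  | soEven, n => n
  | soOdd, n => n

lemma map_mem_vertices (c : ClassicalFamily) (n : ℕ) (g : c.Vec n F ≃ₗ[F] c.Vec n F)
    (hg : g ∈ group F c n) (U : Submodule F (c.Vec n F)) (hU : U ∈ vertices F c n) :
    U.map (g : c.Vec n F →ₗ[F] c.Vec n F) ∈ vertices F c n := by
  have hbot : U ≠ ⊥ → U.map (g : c.Vec n F →ₗ[F] c.Vec n F) ≠ ⊥ := fun h h' =>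
    h ((Submodule.map_eq_bot_iff (p := U) (e := g)).1 h')
  have htop : U ≠ ⊤ → U.map (g : c.Vec n F →ₗ[F] c.Vec n F) ≠ ⊤ := fun h h' =>
    h ((Submodule.map_eq_top_iff (p := U) (e := g)).1 h')
  cases c with
  | gl => exact ⟨hbot hU.1, htop hU.2⟩
  | sl => exact ⟨hbot hU.1, htop hU.2⟩
  | sp =>
    refine ⟨hbot hU.1, ?_⟩
    rintro _ ⟨v, hv, rfl⟩ _ ⟨w, hw, rfl⟩
    exact (hg v w).trans (hU.2 v hv w hw)
  | soEven =>
    refine ⟨hbot hU.1, ?_⟩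
    rintro _ ⟨v, hv, rfl⟩
    exact (hg.2 v).trans (hU.2 v hv)
  | soOdd =>
    refine ⟨hbot hU.1, ?_⟩
    rintro _ ⟨v, hv, rfl⟩
    exact (hg.2 v).trans (hU.2 v hv)

lemma strictMono_map (c : ClassicalFamily) (n : ℕ) (g : c.Vec n F ≃ₗ[F] c.Vec n F) :
    StrictMono (Submodule.map (g : c.Vec n F →ₗ[F] c.Vec n F)) :=
  Submodule.map_strictMono_of_injective g.injective

/-- The Steinberg module `St_{G_n}(F; R)`: the reduced homology of the Tits building in its top
degree. -/
abbrev Steinberg (F : Type u) [Field F] (R : Type u) [CommRing R] (c : ClassicalFamily) (n : ℕ) :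
    Type u :=
  RedHomology R (vertices F c n) (c.rank n)

/-- The Steinberg representation: `G_n(F)` acts through its action on subspaces. -/
def steinbergRep (F : Type u) [Field F] (R : Type u) [CommRing R] (c : ClassicalFamily) (n : ℕ) :
    Representation R (group F c n) (Steinberg F R c n) where
  toFun g := RedHomology.vertexMap R
    (Submodule.map ((g : c.Vec n F ≃ₗ[F] c.Vec n F) : c.Vec n F →ₗ[F] c.Vec n F))
    (strictMono_map c n g.1) (map_mem_vertices c n g.1 g.2) (c.rank n)
  map_one' := by
    apply LinearMap.ext
    rintro ⟨_, z, hz, rfl⟩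
    apply Subtype.ext
    have : List.map (Submodule.map (((1 : group F c n) : c.Vec n F ≃ₗ[F] c.Vec n F) :
        c.Vec n F →ₗ[F] c.Vec n F)) = id := by
      funext l
      have : Submodule.map (((1 : group F c n) : c.Vec n F ≃ₗ[F] c.Vec n F) :
        c.Vec n F →ₗ[F] c.Vec n F) = id := by
        funext U; exact Submodule.map_id U
      rw [this, List.map_id, id]
    change Submodule.mkQ _ (OrderComplex.vertexMap R _ z) = Submodule.mkQ _ z
    rw [OrderComplex.vertexMap, this, Finsupp.lmapDomain_id, LinearMap.id_apply]
  map_mul' g h := by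
    apply LinearMap.ext
    rintro ⟨_, z, hz, rfl⟩
    apply Subtype.ext
    have hmul : Submodule.map (((g * h : group F c n) : c.Vec n F ≃ₗ[F] c.Vec n F) :
        c.Vec n F →ₗ[F] c.Vec n F) =
        Submodule.map ((g : c.Vec n F ≃ₗ[F] c.Vec n F) : c.Vec n F →ₗ[F] c.Vec n F) ∘
        Submodule.map ((h : c.Vec n F ≃ₗ[F] c.Vec n F) : c.Vec n F →ₗ[F] c.Vec n F) := by
      funext U
      exact Submodule.map_comp _ _ U
    change Submodule.mkQ _ (OrderComplex.vertexMap R _ z) =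
      Submodule.mkQ _ (OrderComplex.vertexMap R _ (OrderComplex.vertexMap R _ z))
    congr 1
    rw [hmul]
    simp only [OrderComplex.vertexMap, Finsupp.lmapDomain_apply, ← Finsupp.mapDomain_comp]
    congr 1
    funext l
    simp

/-- The Steinberg representation as an object of the category of representations. -/
abbrev St (F : Type u) [Field F] (R : Type u) [CommRing R] (c : ClassicalFamily) (n : ℕ) :
    Rep R (group F c n) :=
  Rep.of (steinbergRep F R c n)

/-! ### The standard inclusion of `G_n` into `G_{n+1}` -/

/-- The inclusion of the index set of the basis of the span `V_n` of all standard basis vectors other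
than `a_1` (and `b_1`), which shifts the indices of the `a_j` and `b_j` by one. -/
def shift : (c : ClassicalFamily) → (n : ℕ) → c.Idx n → c.Idx (n + 1)
  | gl, _ => Fin.succ
  | sl, _ => Fin.succ
  | sp, _ => Sum.map Fin.succ Fin.succ
  | soEven, _ => Sum.map Fin.succ Fin.succ
  | soOdd, _ => Sum.map (Sum.map Fin.succ Fin.succ) id

lemma shift_injective (c : ClassicalFamily) (n : ℕ) : Function.Injective (c.shift n) := by
  have h := Fin.succ_injective n
  cases c with
  | gl => exact h
  | sl => exact h
  | sp => exact h.sumMap h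
  | soEven => exact h.sumMap h
  | soOdd => exact (h.sumMap h).sumMap Function.injective_id

variable (F) in
/-- The shift of standard basis vectors `V_n → V_{n+1}` with `a_j ↦ a_{j+1}`, `b_j ↦ b_{j+1}`,
`e ↦ e`. -/
def incl (c : ClassicalFamily) (n : ℕ) : c.Vec n F →ₗ[F] c.Vec (n + 1) F :=
  Function.ExtendByZero.linearMap F (c.shift n)

variable (F) in
/-- The restriction of coordinates `V_{n+1} → V_n`. -/
def restr (c : ClassicalFamily) (n : ℕ) : c.Vec (n + 1) F →ₗ[F] c.Vec n F :=
  LinearMap.funLeft F F (c.shift n)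

lemma incl_shift (c : ClassicalFamily) (n : ℕ) (v : c.Vec n F) (i : c.Idx n) :
    incl F c n v (c.shift n i) = v i :=
  (c.shift_injective n).extend_apply v (0 : c.Idx (n + 1) → F) i

lemma incl_of_notMem (c : ClassicalFamily) (n : ℕ) (v : c.Vec n F) (i : c.Idx (n + 1))
    (hi : i ∉ Set.range (c.shift n)) : incl F c n v i = 0 :=
  Function.extend_apply' v (0 : c.Idx (n + 1) → F) i hi

lemma restr_incl (c : ClassicalFamily) (n : ℕ) (v : c.Vec n F) :
    restr F c n (incl F c n v) = v := by
  funext i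
  exact incl_shift c n v i

lemma incl_injective (c : ClassicalFamily) (n : ℕ) : Function.Injective (incl F c n) :=
  Function.LeftInverse.injective (restr_incl c n)

/-- The extension of an endomorphism of `V_n` to `V_{n+1}` which is the identity on the new basis
vectors. -/
def extendEnd (c : ClassicalFamily) (n : ℕ) (g : c.Vec n F →ₗ[F] c.Vec n F) :
    c.Vec (n + 1) F →ₗ[F] c.Vec (n + 1) F :=
  LinearMap.id + incl F c n ∘ₗ (g - LinearMap.id) ∘ₗ restr F c n

lemma extendEnd_apply (c : ClassicalFamily) (n : ℕ) (g : c.Vec n F →ₗ[F] c.Vec n F)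
    (v : c.Vec (n + 1) F) :
    extendEnd c n g v = v + incl F c n (g (restr F c n v) - restr F c n v) := rfl

lemma restr_extendEnd (c : ClassicalFamily) (n : ℕ) (g : c.Vec n F →ₗ[F] c.Vec n F)
    (v : c.Vec (n + 1) F) :
    restr F c n (extendEnd c n g v) = g (restr F c n v) := by
  rw [extendEnd_apply, map_add, restr_incl]; abel

lemma extendEnd_incl (c : ClassicalFamily) (n : ℕ) (g : c.Vec n F →ₗ[F] c.Vec n F)
    (v : c.Vec n F) :
    extendEnd c n g (incl F c n v) = incl F c n (g v) := by
  rw [extendEnd_apply, restr_incl, map_sub]; abel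

lemma extendEnd_shift (c : ClassicalFamily) (n : ℕ) (g : c.Vec n F →ₗ[F] c.Vec n F)
    (v : c.Vec (n + 1) F) (i : c.Idx n) :
    extendEnd c n g v (c.shift n i) = g (restr F c n v) i :=
  congrFun (restr_extendEnd c n g v) i

lemma extendEnd_of_notMem (c : ClassicalFamily) (n : ℕ) (g : c.Vec n F →ₗ[F] c.Vec n F)
    (v : c.Vec (n + 1) F) (i : c.Idx (n + 1)) (hi : i ∉ Set.range (c.shift n)) :
    extendEnd c n g v i = v i := by
  rw [extendEnd_apply, Pi.add_apply, incl_of_notMem c n _ i hi, add_zero]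

lemma extendEnd_comp (c : ClassicalFamily) (n : ℕ) (g h : c.Vec n F →ₗ[F] c.Vec n F) :
    extendEnd c n (g ∘ₗ h) = extendEnd c n g ∘ₗ extendEnd c n h := by
  apply LinearMap.ext
  intro v
  rw [LinearMap.comp_apply, extendEnd_apply c n g, restr_extendEnd, extendEnd_apply,
    extendEnd_apply, LinearMap.comp_apply]
  simp only [map_sub]
  abel

lemma extendEnd_id (c : ClassicalFamily) (n : ℕ) :
    extendEnd c n (LinearMap.id : c.Vec n F →ₗ[F] c.Vec n F) = LinearMap.id := by
  apply LinearMap.ext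
  intro v
  rw [extendEnd_apply, LinearMap.id_apply, sub_self, map_zero, add_zero, LinearMap.id_apply]

lemma det_extendEnd (c : ClassicalFamily) (n : ℕ) (g : c.Vec n F →ₗ[F] c.Vec n F) :
    LinearMap.det (extendEnd c n g) = LinearMap.det g := by
  have h1 : LinearMap.toMatrix' (extendEnd c n g) =
      1 + LinearMap.toMatrix' (incl F c n) *
        LinearMap.toMatrix' ((g - LinearMap.id) ∘ₗ restr F c n) := by
    rw [← LinearMap.toMatrix'_comp, extendEnd, map_add, LinearMap.toMatrix'_id]
  have h2 : (g - LinearMap.id) ∘ₗ restr F c n ∘ₗ incl F c n = g - LinearMap.id := by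
    apply LinearMap.ext
    intro v
    exact congrArg (g - LinearMap.id : c.Vec n F →ₗ[F] c.Vec n F) (restr_incl c n v)
  rw [← LinearMap.det_toMatrix', h1, Matrix.det_one_add_mul_comm, ← LinearMap.toMatrix'_comp,
    LinearMap.comp_assoc, h2, map_sub, LinearMap.toMatrix'_id, add_sub_cancel,
    LinearMap.det_toMatrix']

/-- The extension of an automorphism of `V_n` to `V_{n+1}` which is the identity on the new basis
vectors. -/
def extendAut (c : ClassicalFamily) (n : ℕ) :
    (c.Vec n F ≃ₗ[F] c.Vec n F) →* (c.Vec (n + 1) F ≃ₗ[F] c.Vec (n + 1) F) where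
  toFun g := LinearEquiv.ofLinearMap (extendEnd c n g) (extendEnd c n g.symm)
    (by rw [← extendEnd_comp, LinearEquiv.comp_symm, extendEnd_id])
    (by rw [← extendEnd_comp, LinearEquiv.symm_comp, extendEnd_id])
  map_one' := by
    ext1 v
    exact LinearMap.congr_fun (extendEnd_id c n) v
  map_mul' g h := by
    ext1 v
    exact LinearMap.congr_fun (extendEnd_comp c n (g : c.Vec n F →ₗ[F] c.Vec n F) h) v

lemma coe_extendAut (c : ClassicalFamily) (n : ℕ) (g : c.Vec n F ≃ₗ[F] c.Vec n F) :
    (extendAut c n g : c.Vec (n + 1) F →ₗ[F] c.Vec (n + 1) F) = extendEnd c n g := rfl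

lemma symplecticForm_succ (n : ℕ) (v w : Vec sp (n + 1) F) :
    symplecticForm (n + 1) v w = v (.inl 0) * w (.inr 0) - v (.inr 0) * w (.inl 0) +
      symplecticForm n (restr F sp n v) (restr F sp n w) := by
  rw [symplecticForm, Fin.sum_univ_succ]; rfl

lemma quadEven_succ (n : ℕ) (v : Vec soEven (n + 1) F) :
    quadEven (n + 1) v = v (.inl 0) * v (.inr 0) + quadEven n (restr F soEven n v) := by
  rw [quadEven, Fin.sum_univ_succ]; rfl

lemma quadOdd_succ (n : ℕ) (v : Vec soOdd (n + 1) F) :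
    quadOdd (n + 1) v =
      v (.inl (.inl 0)) * v (.inl (.inr 0)) + quadOdd n (restr F soOdd n v) := by
  rw [quadOdd, Fin.sum_univ_succ, add_left_comm]; rfl

lemma extendAut_mem (c : ClassicalFamily) (n : ℕ) (g : c.Vec n F ≃ₗ[F] c.Vec n F)
    (hg : g ∈ group F c n) : extendAut c n g ∈ group F c (n + 1) := by
  have hdet : g ∈ LinearEquiv.det.ker → extendAut c n g ∈ LinearEquiv.det.ker := by
    intro h
    rw [MonoidHom.mem_ker] at h ⊢
    apply Units.ext
    have h' := congrArg Units.val h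
    rw [LinearEquiv.coe_det] at h' ⊢
    rw [coe_extendAut, det_extendEnd, h']
  cases c with
  | gl => exact Subgroup.mem_top _
  | sl => exact hdet hg
  | sp =>
    intro v w
    have key := hg (restr F sp n v) (restr F sp n w)
    have e0 : ∀ v, extendAut sp n g v = extendEnd sp n g v := fun _ => rfl
    have e1 : ∀ v : Vec sp (n + 1) F, extendEnd sp n (g : Vec sp n F →ₗ[F] Vec sp n F) v (.inl 0) =
        v (.inl 0) := fun v => extendEnd_of_notMem sp n _ v _ (by rintro ⟨i | i, h⟩ <;> simp [shift] at h)
    have e2 : ∀ v : Vec sp (n + 1) F, extendEnd sp n (g : Vec sp n F →ₗ[F] Vec sp n F) v (.inr 0) =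
        v (.inr 0) := fun v => extendEnd_of_notMem sp n _ v _ (by rintro ⟨i | i, h⟩ <;> simp [shift] at h)
    rw [symplecticForm_succ, symplecticForm_succ, e0, e0, e1, e1, e2, e2, restr_extendEnd,
      restr_extendEnd]
    exact congrArg _ key
  | soEven =>
    refine ⟨hdet hg.1, fun v => ?_⟩
    have key := hg.2 (restr F soEven n v)
    have e0 : extendAut soEven n g v = extendEnd soEven n g v := rfl
    have e1 : extendEnd soEven n (g : Vec soEven n F →ₗ[F] Vec soEven n F) v (.inl 0) =
        v (.inl 0) := extendEnd_of_notMem soEven n _ v _ (by rintro ⟨i | i, h⟩ <;> simp [shift] at h)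
    have e2 : extendEnd soEven n (g : Vec soEven n F →ₗ[F] Vec soEven n F) v (.inr 0) =
        v (.inr 0) := extendEnd_of_notMem soEven n _ v _ (by rintro ⟨i | i, h⟩ <;> simp [shift] at h)
    rw [quadEven_succ, quadEven_succ, e0, e1, e2, restr_extendEnd]
    exact congrArg _ key
  | soOdd =>
    refine ⟨hdet hg.1, fun v => ?_⟩
    have key := hg.2 (restr F soOdd n v)
    have e0 : extendAut soOdd n g v = extendEnd soOdd n g v := rfl
    have e1 : extendEnd soOdd n (g : Vec soOdd n F →ₗ[F] Vec soOdd n F) v (.inl (.inl 0)) =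
        v (.inl (.inl 0)) := extendEnd_of_notMem soOdd n _ v _
          (by rintro ⟨(i | i) | i, h⟩ <;> simp [shift] at h)
    have e2 : extendEnd soOdd n (g : Vec soOdd n F →ₗ[F] Vec soOdd n F) v (.inl (.inr 0)) =
        v (.inl (.inr 0)) := extendEnd_of_notMem soOdd n _ v _
          (by rintro ⟨(i | i) | i, h⟩ <;> simp [shift] at h)
    rw [quadOdd_succ, quadOdd_succ, e0, e1, e2, restr_extendEnd]
    exact congrArg _ key

variable (F) in
/-- The standard inclusion `G_n(F) → G_{n+1}(F)`, onto the subgroup of the Levi subgroup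
`L_{n+1}^1` that fixes `a_1` (and `b_1`). -/
def stabHom (c : ClassicalFamily) (n : ℕ) : group F c n →* group F c (n + 1) where
  toFun g := ⟨extendAut c n g.1, extendAut_mem c n g.1 g.2⟩
  map_one' := Subtype.ext (map_one (extendAut c n))
  map_mul' g h := Subtype.ext (map_mul (extendAut c n) g.1 h.1)

/-! ### The Reeder product map `St_{GL_1} ⊗ St_{G_n} → St_{G_{n+1}}` -/

/-- The index of the standard basis vector `a_1`. -/
def idxA : (c : ClassicalFamily) → (n : ℕ) → c.Idx (n + 1)
  | gl, _ => (0 : Fin _)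
  | sl, _ => (0 : Fin _)
  | sp, _ => .inl 0
  | soEven, _ => .inl 0
  | soOdd, _ => .inl (.inl 0)

variable (F) in
/-- The line spanned by a standard basis vector. -/
def line (c : ClassicalFamily) (n : ℕ) (i : c.Idx n) : Submodule F (c.Vec n F) :=
  Submodule.span F {Pi.single i 1}

/-- The second pole of the suspension: for `GL` and `SL` this is the span of all standard basis
vectors other than `a_1`, and in the other cases it is the line spanned by `b_1`. -/
def secondPole (F : Type u) [Field F] (R : Type u) [CommRing R] :
    (c : ClassicalFamily) → (n : ℕ) → (List (Submodule F (c.Vec (n + 1) F)) →₀ R) →ₗ[R]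
      (List (Submodule F (c.Vec (n + 1) F)) →₀ R)
  | gl, n => topPole R (LinearMap.range (incl F gl n))
  | sl, n => topPole R (LinearMap.range (incl F sl n))
  | sp, n => pole R (line F sp (n + 1) (.inr 0)) ⊥
  | soEven, n => pole R (line F soEven (n + 1) (.inr 0)) ⊥
  | soOdd, n => pole R (line F soOdd (n + 1) (.inl (.inr 0))) ⊥

/-- The Reeder product map with the generator of `St_{GL_1} = R`, on chains: the suspension of the
building of `V_n` inside the building of `V_{n+1}`. Write `W` for the span in `V_{n+1}` of all standard
basis vectors other than `a_1` (and `b_1`), and identify `V_n` with `W`. For `GL` and `SL`, a flag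
`U_1 < ⋯ < U_d` of `W` is sent to
`∑_{j=0}^{d} (-1)^j (U_1 < ⋯ < U_j < U_j + ⟨a_1⟩ < ⋯ < U_d + ⟨a_1⟩) - (-1)^d (U_1 < ⋯ < U_d < W)`
where `U_0 = 0`; in the other cases it is sent to
`∑_{j=0}^{d} (-1)^j (U_1 < ⋯ < U_j < U_j + ⟨a_1⟩ < ⋯ < U_d + ⟨a_1⟩)
  - ∑_{j=0}^{d} (-1)^j (U_1 < ⋯ < U_j < U_j + ⟨b_1⟩ < ⋯ < U_d + ⟨b_1⟩)`.
It sends the apartment of a basis (or frame) of `W` to the apartment of the basis (frame) of `V_{n+1}`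
obtained by adding `a_1` (the hyperbolic pair `a_1, b_1`). -/
def reederChain (F : Type u) [Field F] (R : Type u) [CommRing R] (c : ClassicalFamily) (n : ℕ) :
    (List (Submodule F (c.Vec n F)) →₀ R) →ₗ[R] (List (Submodule F (c.Vec (n + 1) F)) →₀ R) :=
  (pole R (line F c (n + 1) (c.idxA n)) ⊥ - secondPole F R c n) ∘ₗ
    vertexMap R (Submodule.map (incl F c n))

lemma boundary_reederChain (R : Type u) [CommRing R] (c : ClassicalFamily) (n : ℕ)
    (z : List (Submodule F (c.Vec n F)) →₀ R) :
    boundary R (reederChain F R c n z) = (-1 : R) • reederChain F R c n (boundary R z) := by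
  have h : ∀ y, boundary R (secondPole F R c n y) = y - secondPole F R c n (boundary R y) := by
    intro y
    cases c with
    | gl => exact boundary_topPole R _ y
    | sl => exact boundary_topPole R _ y
    | sp => exact boundary_pole R _ _ y
    | soEven => exact boundary_pole R _ _ y
    | soOdd => exact boundary_pole R _ _ y
  simp only [reederChain, LinearMap.comp_apply, LinearMap.sub_apply, map_sub, h, boundary_pole,
    boundary_vertexMap, neg_smul, one_smul]
  abel

lemma mem_line {c : ClassicalFamily} {n : ℕ} {i : c.Idx n} {v : c.Vec n F} :
    v ∈ line F c n i ↔ ∃ t : F, t • Pi.single i 1 = v :=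
  Submodule.mem_span_singleton

lemma line_ne_bot (c : ClassicalFamily) (n : ℕ) (i : c.Idx n) : line F c n i ≠ ⊥ := by
  intro h
  rw [line, Submodule.span_singleton_eq_bot] at h
  have := congrFun h i
  rw [Pi.single_eq_same] at this
  exact one_ne_zero this

lemma restr_single (c : ClassicalFamily) (n : ℕ) (i : c.Idx (n + 1))
    (hi : i ∉ Set.range (c.shift n)) : restr F c n (Pi.single i 1) = 0 := by
  funext j
  change (Pi.single i 1 : c.Vec (n + 1) F) (c.shift n j) = 0
  exact Pi.single_eq_of_ne (fun h => hi ⟨j, h⟩) _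

lemma disjoint_line (c : ClassicalFamily) (n : ℕ) (i : c.Idx (n + 1))
    (hi : i ∉ Set.range (c.shift n)) (U : Submodule F (c.Vec n F)) :
    Disjoint (U.map (incl F c n)) (line F c (n + 1) i) := by
  rw [Submodule.disjoint_def]
  rintro _ ⟨u, _, rfl⟩ hu
  obtain ⟨t, ht⟩ := mem_line.1 hu
  have : restr F c n (incl F c n u) = 0 := by
    rw [← ht, map_smul, restr_single c n i hi, smul_zero]
  rw [restr_incl] at this
  rw [this, map_zero]

lemma mem_sup_line {c : ClassicalFamily} {n : ℕ} {i : c.Idx (n + 1)} {U : Submodule F (c.Vec n F)}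
    {v : c.Vec (n + 1) F} (hv : v ∈ U.map (incl F c n) ⊔ line F c (n + 1) i) :
    ∃ u ∈ U, ∃ t : F, v = incl F c n u + t • Pi.single i 1 := by
  obtain ⟨_, ⟨u, hu, rfl⟩, y, hy, rfl⟩ := Submodule.mem_sup.1 hv
  obtain ⟨t, rfl⟩ := mem_line.1 hy
  exact ⟨u, hu, t, rfl⟩

lemma restr_add_single (c : ClassicalFamily) (n : ℕ) (i : c.Idx (n + 1))
    (hi : i ∉ Set.range (c.shift n)) (u : c.Vec n F) (t : F) :
    restr F c n (incl F c n u + t • Pi.single i 1) = u := by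
  rw [map_add, map_smul, restr_single c n i hi, smul_zero, add_zero, restr_incl]

lemma sup_line_ne_bot (c : ClassicalFamily) (n : ℕ) (i : c.Idx (n + 1))
    (U : Submodule F (c.Vec n F)) : U.map (incl F c n) ⊔ line F c (n + 1) i ≠ ⊥ := fun h =>
  line_ne_bot c (n + 1) i (le_bot_iff.1 (h ▸ le_sup_right))

lemma sup_line_ne_top (c : ClassicalFamily) (n : ℕ) (i : c.Idx (n + 1))
    (hi : i ∉ Set.range (c.shift n)) (U : Submodule F (c.Vec n F)) (hU : U ≠ ⊤) :
    U.map (incl F c n) ⊔ line F c (n + 1) i ≠ ⊤ := by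
  intro h
  apply hU
  rw [Submodule.eq_top_iff']
  intro v
  have hv : incl F c n v ∈ U.map (incl F c n) ⊔ line F c (n + 1) i := by rw [h]; trivial
  obtain ⟨u, hu, t, hut⟩ := mem_sup_line hv
  have := congrArg (restr F c n) hut
  rw [restr_add_single c n i hi, restr_incl] at this
  rwa [this]

lemma range_incl_ne_top (c : ClassicalFamily) (n : ℕ) (i : c.Idx (n + 1))
    (hi : i ∉ Set.range (c.shift n)) : LinearMap.range (incl F c n) ≠ ⊤ := by
  intro h
  have hv : (Pi.single i 1 : c.Vec (n + 1) F) ∈ LinearMap.range (incl F c n) := by rw [h]; trivial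
  obtain ⟨u, hu⟩ := hv
  have := congrFun hu i
  rw [incl_of_notMem c n u i hi, Pi.single_eq_same] at this
  exact zero_ne_one this

lemma map_incl_ne_bot (c : ClassicalFamily) (n : ℕ) (U : Submodule F (c.Vec n F)) (hU : U ≠ ⊥) :
    U.map (incl F c n) ≠ ⊥ := fun h =>
  hU (Submodule.map_injective_of_injective (incl_injective c n) (h.trans (Submodule.map_bot _).symm))

/-- The index `i` is that of a basis vector `a_1` or `b_1`. -/
def IsNew : (c : ClassicalFamily) → (n : ℕ) → c.Idx (n + 1) → Prop
  | gl, _, i => i = (0 : Fin _)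
  | sl, _, i => i = (0 : Fin _)
  | sp, _, i => i = .inl 0 ∨ i = .inr 0
  | soEven, _, i => i = .inl 0 ∨ i = .inr 0
  | soOdd, _, i => i = .inl (.inl 0) ∨ i = .inl (.inr 0)

lemma IsNew.notMem {c : ClassicalFamily} {n : ℕ} {i : c.Idx (n + 1)} (hi : IsNew c n i) :
    i ∉ Set.range (c.shift n) := by
  cases c with
  | gl => rcases hi with rfl; rintro ⟨j, h⟩; exact Fin.succ_ne_zero j h
  | sl => rcases hi with rfl; rintro ⟨j, h⟩; exact Fin.succ_ne_zero j h
  | sp => rcases hi with rfl | rfl <;> rintro ⟨j | j, h⟩ <;> simp [shift] at h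
  | soEven => rcases hi with rfl | rfl <;> rintro ⟨j | j, h⟩ <;> simp [shift] at h
  | soOdd => rcases hi with rfl | rfl <;> rintro ⟨(j | j) | j, h⟩ <;> simp [shift] at h

lemma isNew_idxA (c : ClassicalFamily) (n : ℕ) : IsNew c n (c.idxA n) := by
  cases c with
  | gl => exact rfl
  | sl => exact rfl
  | sp => exact Or.inl rfl
  | soEven => exact Or.inl rfl
  | soOdd => exact Or.inl rfl

lemma quadEven_add (n : ℕ) (i : Idx soEven (n + 1)) (hi : IsNew soEven n i) (u : Vec soEven n F)
    (t : F) : quadEven (n + 1) (incl F soEven n u + t • Pi.single i 1) = quadEven n u := by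
  rw [quadEven_succ, restr_add_single soEven n i hi.notMem]
  have h1 : incl F soEven n u (.inl 0) = 0 :=
    incl_of_notMem soEven n u _ (IsNew.notMem (c := soEven) (Or.inl rfl))
  have h2 : incl F soEven n u (.inr 0) = 0 :=
    incl_of_notMem soEven n u _ (IsNew.notMem (c := soEven) (Or.inr rfl))
  rw [Pi.add_apply, Pi.add_apply, h1, h2]
  rcases hi with rfl | rfl <;> simp

lemma quadOdd_add (n : ℕ) (i : Idx soOdd (n + 1)) (hi : IsNew soOdd n i) (u : Vec soOdd n F)
    (t : F) : quadOdd (n + 1) (incl F soOdd n u + t • Pi.single i 1) = quadOdd n u := by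
  rw [quadOdd_succ, restr_add_single soOdd n i hi.notMem]
  have h1 : incl F soOdd n u (.inl (.inl 0)) = 0 :=
    incl_of_notMem soOdd n u _ (IsNew.notMem (c := soOdd) (Or.inl rfl))
  have h2 : incl F soOdd n u (.inl (.inr 0)) = 0 :=
    incl_of_notMem soOdd n u _ (IsNew.notMem (c := soOdd) (Or.inr rfl))
  rw [Pi.add_apply, Pi.add_apply, h1, h2]
  rcases hi with rfl | rfl <;> simp

lemma symplecticForm_add (n : ℕ) (i : Idx sp (n + 1)) (hi : IsNew sp n i) (u w : Vec sp n F)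
    (t s : F) : symplecticForm (n + 1) (incl F sp n u + t • Pi.single i 1)
      (incl F sp n w + s • Pi.single i 1) = symplecticForm n u w := by
  rw [symplecticForm_succ, restr_add_single sp n i hi.notMem, restr_add_single sp n i hi.notMem]
  have h1 : ∀ u : Vec sp n F, incl F sp n u (.inl 0) = 0 := fun u =>
    incl_of_notMem sp n u _ (IsNew.notMem (c := sp) (Or.inl rfl))
  have h2 : ∀ u : Vec sp n F, incl F sp n u (.inr 0) = 0 := fun u =>
    incl_of_notMem sp n u _ (IsNew.notMem (c := sp) (Or.inr rfl))
  rw [Pi.add_apply, Pi.add_apply, Pi.add_apply, Pi.add_apply, h1, h2, h1, h2]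
  rcases hi with rfl | rfl <;> simp

lemma sup_line_mem (c : ClassicalFamily) (n : ℕ) (i : c.Idx (n + 1)) (hi : IsNew c n i)
    (U : Submodule F (c.Vec n F)) (hU : U ∈ vertices F c n) :
    U.map (incl F c n) ⊔ line F c (n + 1) i ∈ vertices F c (n + 1) := by
  cases c with
  | gl => exact ⟨sup_line_ne_bot _ n i U, sup_line_ne_top _ n i hi.notMem U hU.2⟩
  | sl => exact ⟨sup_line_ne_bot _ n i U, sup_line_ne_top _ n i hi.notMem U hU.2⟩
  | sp =>
    refine ⟨sup_line_ne_bot _ n i U, fun v hv w hw => ?_⟩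
    obtain ⟨x, hx, t, rfl⟩ := mem_sup_line hv
    obtain ⟨y, hy, s, rfl⟩ := mem_sup_line hw
    exact (symplecticForm_add n i hi x y t s).trans (hU.2 x hx y hy)
  | soEven =>
    refine ⟨sup_line_ne_bot _ n i U, fun v hv => ?_⟩
    obtain ⟨x, hx, t, rfl⟩ := mem_sup_line hv
    exact (quadEven_add n i hi x t).trans (hU.2 x hx)
  | soOdd =>
    refine ⟨sup_line_ne_bot _ n i U, fun v hv => ?_⟩
    obtain ⟨x, hx, t, rfl⟩ := mem_sup_line hv
    exact (quadOdd_add n i hi x t).trans (hU.2 x hx)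

lemma mem_of_le (c : ClassicalFamily) (n : ℕ) {U U' : Submodule F (c.Vec n F)}
    (hU' : U' ∈ vertices F c n) (h : U ≤ U') (hU : U ≠ ⊥) : U ∈ vertices F c n := by
  cases c with
  | gl => exact ⟨hU, fun h' => hU'.2 (top_le_iff.1 (h' ▸ h))⟩
  | sl => exact ⟨hU, fun h' => hU'.2 (top_le_iff.1 (h' ▸ h))⟩
  | sp => exact ⟨hU, fun v hv w hw => hU'.2 v (h hv) w (h hw)⟩
  | soEven => exact ⟨hU, fun v hv => hU'.2 v (h hv)⟩
  | soOdd => exact ⟨hU, fun v hv => hU'.2 v (h hv)⟩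

lemma line_mem (c : ClassicalFamily) (n : ℕ) (i : c.Idx (n + 2)) (hi : IsNew c (n + 1) i) :
    line F c (n + 2) i ∈ vertices F c (n + 2) := by
  have hline : ∀ v ∈ line F c (n + 2) i, ∃ t : F,
      v = incl F c (n + 1) 0 + t • Pi.single i 1 := by
    intro v hv
    obtain ⟨t, ht⟩ := mem_line.1 hv
    exact ⟨t, by rw [map_zero, zero_add, ht]⟩
  have hgl : (∃ j : c.Idx (n + 1), True) → line F c (n + 2) i ≠ ⊤ := by
    rintro ⟨j, -⟩ h
    have hv : incl F c (n + 1) (Pi.single j 1) ∈ line F c (n + 2) i := by rw [h]; trivial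
    obtain ⟨t, ht⟩ := hline _ hv
    have := congrArg (restr F c (n + 1)) ht
    rw [restr_incl, restr_add_single c (n + 1) i hi.notMem] at this
    have := congrFun this j
    rw [Pi.single_eq_same] at this
    exact one_ne_zero this
  cases c with
  | gl => exact ⟨line_ne_bot _ _ i, hgl ⟨(0 : Fin (n + 1)), trivial⟩⟩
  | sl => exact ⟨line_ne_bot _ _ i, hgl ⟨(0 : Fin (n + 1)), trivial⟩⟩
  | sp =>
    refine ⟨line_ne_bot _ _ i, fun v hv w hw => ?_⟩
    obtain ⟨t, rfl⟩ := hline v hv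
    obtain ⟨s, rfl⟩ := hline w hw
    refine (symplecticForm_add (n + 1) i hi 0 0 t s).trans ?_
    simp [symplecticForm]
  | soEven =>
    refine ⟨line_ne_bot _ _ i, fun v hv => ?_⟩
    obtain ⟨t, rfl⟩ := hline v hv
    refine (quadEven_add (n + 1) i hi 0 t).trans ?_
    simp [quadEven]
  | soOdd =>
    refine ⟨line_ne_bot _ _ i, fun v hv => ?_⟩
    obtain ⟨t, rfl⟩ := hline v hv
    refine (quadOdd_add (n + 1) i hi 0 t).trans ?_
    simp [quadOdd]

lemma ne_bot_of_mem {c : ClassicalFamily} {n : ℕ} {U : Submodule F (c.Vec n F)}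
    (hU : U ∈ vertices F c n) : U ≠ ⊥ := by
  cases c with
  | gl => exact hU.1
  | sl => exact hU.1
  | sp => exact hU.1
  | soEven => exact hU.1
  | soOdd => exact hU.1

lemma map_incl_mem (c : ClassicalFamily) (n : ℕ) (U : Submodule F (c.Vec n F))
    (hU : U ∈ vertices F c n) : U.map (incl F c n) ∈ vertices F c (n + 1) :=
  mem_of_le c (n + 1) (sup_line_mem c n _ (isNew_idxA c n) U hU) le_sup_left
    (map_incl_ne_bot c n U (ne_bot_of_mem hU))

lemma pole_line_mem (R : Type u) [CommRing R] (c : ClassicalFamily) (n : ℕ) (i : c.Idx (n + 2))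
    (hi : IsNew c (n + 1) i) (l : List (Submodule F (c.Vec (n + 1) F)))
    (h1 : l.Pairwise (· < ·)) (h2 : ∀ U ∈ l, U ∈ vertices F c (n + 1)) :
    pole R (line F c (n + 2) i) ⊥
      (Finsupp.single (l.map (Submodule.map (incl F c (n + 1)))) 1) ∈
      chains R (vertices F c (n + 2)) (l.length + 1) := by
  have h := pole_single_mem R (Y := vertices F c (n + 2)) (line_ne_bot c (n + 2) i)
    (line_mem c n i hi) (l := l.map (Submodule.map (incl F c (n + 1)))) ?_ ?_
  · rwa [List.length_map] at h
  · exact List.pairwise_map.2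
      (h1.imp fun h => Submodule.map_strictMono_of_injective (incl_injective c (n + 1)) h)
  · intro U' hU'
    obtain ⟨U, hU, rfl⟩ := List.mem_map.1 hU'
    exact ⟨map_incl_ne_bot c _ U (ne_bot_of_mem (h2 U hU)), map_incl_mem c _ U (h2 U hU),
      disjoint_line c _ i hi.notMem U, sup_line_mem c _ i hi U (h2 U hU)⟩

lemma topPole_range_mem (R : Type u) [CommRing R] (c : ClassicalFamily) (n : ℕ)
    (hW : LinearMap.range (incl F c (n + 1)) ∈ vertices F c (n + 2))
    (l : List (Submodule F (c.Vec (n + 1) F))) (h1 : l.Pairwise (· < ·))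
    (h2 : ∀ U ∈ l, U ∈ vertices F c (n + 1)) (h3 : ∀ U ∈ l, U ≠ ⊤) :
    topPole R (LinearMap.range (incl F c (n + 1)))
      (Finsupp.single (l.map (Submodule.map (incl F c (n + 1)))) 1) ∈
      chains R (vertices F c (n + 2)) (l.length + 1) := by
  have hmono := Submodule.map_strictMono_of_injective (incl_injective (F := F) c (n + 1))
  have h := topPole_single_mem R (Y := vertices F c (n + 2)) hW
    (l := l.map (Submodule.map (incl F c (n + 1)))) ?_ ?_
  · rwa [List.length_map] at h
  · exact List.pairwise_map.2 (h1.imp fun h => hmono h)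
  · intro U' hU'
    obtain ⟨U, hU, rfl⟩ := List.mem_map.1 hU'
    refine ⟨map_incl_mem c _ U (h2 U hU), ?_⟩
    rw [LinearMap.range_eq_map]
    exact hmono (lt_top_iff_ne_top.2 (h3 U hU))

lemma reederChain_mem (R : Type u) [CommRing R] (c : ClassicalFamily) (n d : ℕ) :
    ∀ z ∈ chains R (vertices F c (n + 1)) d,
      reederChain F R c (n + 1) z ∈ chains R (vertices F c (n + 2)) (d + 1) := by
  apply chains_le_of_single
  rintro l h1 h2 rfl
  rw [reederChain, LinearMap.comp_apply, vertexMap_single, LinearMap.sub_apply]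
  refine Submodule.sub_mem _ (pole_line_mem R c n _ (isNew_idxA c _) l h1 h2) ?_
  have hne : ∀ (j : c.Idx (n + 1)), LinearMap.range (incl F c (n + 1)) ≠ ⊥ := by
    intro j h
    rw [LinearMap.range_eq_bot] at h
    have := incl_shift (F := F) c (n + 1) (Pi.single j 1) j
    rw [h, Pi.single_eq_same] at this
    exact zero_ne_one this
  cases c with
  | gl =>
    exact topPole_range_mem R gl n ⟨hne (0 : Fin (n + 1)), range_incl_ne_top gl _ _
      (isNew_idxA gl _).notMem⟩ l h1 h2 fun U hU => (h2 U hU).2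
  | sl =>
    exact topPole_range_mem R sl n ⟨hne (0 : Fin (n + 1)), range_incl_ne_top sl _ _
      (isNew_idxA sl _).notMem⟩ l h1 h2 fun U hU => (h2 U hU).2
  | sp => exact pole_line_mem R sp n _ (Or.inr rfl) l h1 h2
  | soEven => exact pole_line_mem R soEven n _ (Or.inr rfl) l h1 h2
  | soOdd => exact pole_line_mem R soOdd n _ (Or.inr rfl) l h1 h2

lemma rank_succ (c : ClassicalFamily) (n : ℕ) : c.rank (n + 2) = c.rank (n + 1) + 1 := by
  cases c <;> rfl

/-- The composition
`St_{G_{n+1}}(F; R) ≅ St_{GL_1}(F; R) ⊗ St_{G_{n+1}}(F; R) → St_{G_{n+2}}(F; R)`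
of the identification `St_{GL_1}(F; R) = R` with the Reeder product map. -/
def reeder (F : Type u) [Field F] (R : Type u) [CommRing R] (c : ClassicalFamily) (n : ℕ) :
    Steinberg F R c (n + 1) →ₗ[R] Steinberg F R c (n + 2) :=
  RedHomology.map R (reederChain F R c (n + 1)) (-1) (by ring) (boundary_reederChain R c (n + 1))
    (by rw [rank_succ]; exact reederChain_mem R c n _)
    (by rw [rank_succ]; exact reederChain_mem R c n _)

lemma extendAut_line (c : ClassicalFamily) (n : ℕ) (g : c.Vec n F ≃ₗ[F] c.Vec n F)
    (i : c.Idx (n + 1)) (hi : i ∉ Set.range (c.shift n)) :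
    (line F c (n + 1) i).map (extendEnd c n (g : c.Vec n F →ₗ[F] c.Vec n F)) =
      line F c (n + 1) i := by
  rw [line, Submodule.map_span, Set.image_singleton, extendEnd_apply, restr_single c n i hi,
    map_zero, sub_zero, map_zero, add_zero]

lemma extendAut_range (c : ClassicalFamily) (n : ℕ) (g : c.Vec n F ≃ₗ[F] c.Vec n F) :
    (LinearMap.range (incl F c n)).map (extendEnd c n (g : c.Vec n F →ₗ[F] c.Vec n F)) =
      LinearMap.range (incl F c n) := by
  apply le_antisymm
  · rintro _ ⟨_, ⟨v, rfl⟩, rfl⟩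
    exact ⟨g v, (extendEnd_incl c n _ v).symm⟩
  · rintro _ ⟨v, rfl⟩
    refine ⟨incl F c n (g.symm v), ⟨_, rfl⟩, ?_⟩
    rw [extendEnd_incl]
    exact congrArg _ (g.apply_symm_apply v)

lemma reederChain_vertexMap (R : Type u) [CommRing R] (c : ClassicalFamily) (n : ℕ)
    (g : c.Vec n F ≃ₗ[F] c.Vec n F) (z : List (Submodule F (c.Vec n F)) →₀ R) :
    reederChain F R c n (vertexMap R (Submodule.map (g : c.Vec n F →ₗ[F] c.Vec n F)) z) =
      vertexMap R (Submodule.map (extendEnd c n (g : c.Vec n F →ₗ[F] c.Vec n F)))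
        (reederChain F R c n z) := by
  have hcomp : vertexMap R (Submodule.map (incl F c n))
      (vertexMap R (Submodule.map (g : c.Vec n F →ₗ[F] c.Vec n F)) z) =
      vertexMap R (Submodule.map (extendEnd c n (g : c.Vec n F →ₗ[F] c.Vec n F)))
        (vertexMap R (Submodule.map (incl F c n)) z) := by
    simp only [OrderComplex.vertexMap, Finsupp.lmapDomain_apply, ← Finsupp.mapDomain_comp]
    congr 1
    funext l
    simp only [Function.comp_apply, List.map_map]
    congr 1
    funext U
    simp only [Function.comp_apply, ← Submodule.map_comp]
    congr 1
    apply LinearMap.ext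
    intro v
    exact (extendEnd_incl c n _ v).symm
  have hpole : ∀ i ∉ Set.range (c.shift n), ∀ y : List (Submodule F (c.Vec (n + 1) F)) →₀ R,
      pole R (line F c (n + 1) i) ⊥
        (vertexMap R (Submodule.map (extendEnd c n (g : c.Vec n F →ₗ[F] c.Vec n F))) y) =
      vertexMap R (Submodule.map (extendEnd c n (g : c.Vec n F →ₗ[F] c.Vec n F)))
        (pole R (line F c (n + 1) i) ⊥ y) := by
    intro i hi y
    rw [vertexMap_pole R _ (fun U V => Submodule.map_sup U V _), extendAut_line c n g i hi,
      Submodule.map_bot]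
  have htop : ∀ y : List (Submodule F (c.Vec (n + 1) F)) →₀ R,
      topPole R (LinearMap.range (incl F c n))
        (vertexMap R (Submodule.map (extendEnd c n (g : c.Vec n F →ₗ[F] c.Vec n F))) y) =
      vertexMap R (Submodule.map (extendEnd c n (g : c.Vec n F →ₗ[F] c.Vec n F)))
        (topPole R (LinearMap.range (incl F c n)) y) := by
    intro y
    rw [vertexMap_topPole, extendAut_range]
  rw [reederChain, LinearMap.comp_apply, LinearMap.comp_apply, hcomp, LinearMap.sub_apply,
    LinearMap.sub_apply, map_sub, hpole _ (isNew_idxA c n).notMem]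
  congr 1
  cases c with
  | gl => exact htop _
  | sl => exact htop _
  | sp => exact hpole _ (IsNew.notMem (c := sp) (Or.inr rfl)) _
  | soEven => exact hpole _ (IsNew.notMem (c := soEven) (Or.inr rfl)) _
  | soOdd => exact hpole _ (IsNew.notMem (c := soOdd) (Or.inr rfl)) _

/-- The map `reeder` is equivariant for the standard inclusion of groups. -/
def reederHom (F : Type u) [Field F] (R : Type u) [CommRing R] (c : ClassicalFamily) (n : ℕ) :
    St F R c (n + 1) ⟶ Rep.res (stabHom F c (n + 1)) (St F R c (n + 2)) :=
  Rep.ofHom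
    { toLinearMap := reeder F R c n
      isIntertwining' := by
        intro g
        apply LinearMap.ext
        rintro ⟨_, z, hz, rfl⟩
        apply Subtype.ext
        exact congrArg (Submodule.mkQ _) (reederChain_vertexMap R c (n + 1) g.1 z) }

/-- The stabilization map
`H_i(G_{n+1}(F); St_{G_{n+1}}(F; R)) → H_i(G_{n+2}(F); St_{G_{n+2}}(F; R))`. -/
def stabilization (F : Type u) [Field F] (R : Type u) [CommRing R] (c : ClassicalFamily)
    (i n : ℕ) : groupHomology (St F R c (n + 1)) i ⟶ groupHomology (St F R c (n + 2)) i :=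
  groupHomology.map (stabHom F c (n + 1)) (reederHom F R c n) i

end

end ClassicalFamily

/-!
The composite of two consecutive stabilization maps is always zero: for
`D : St_{G_n} → St_{G_{n+2}}` the composite of two Reeder maps, there are `g, h ∈ G_{n+2}(F)` that
commute with `G_n(F)` and satisfy `D = g ∘ D + h ∘ D`. Since inner automorphisms act trivially on
group homology (`groupHomology.map_conjAction`), `D`, `g ∘ D` and `h ∘ D` all induce the same map
`Φ` on homology, so `Φ = Φ + Φ` and `Φ = 0`. If both stabilization maps are surjective, then so
is `Φ`, and its target vanishes.

The relation `D = g ∘ D + h ∘ D` is the relation `[p, q] = [p, l] + [l, q]` between apartments of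
the plane `⟨a_1, a_2⟩`, for the three lines `p = ⟨a_1⟩`, `q = ⟨a_2⟩`, `l = ⟨a_1 + a_2⟩`; the elements
`g` and `h` are elementary matrices of that plane carrying `(p, q)` to `(p, l)` and to `(l, q)`,
extended to the dual plane `⟨b_1, b_2⟩` by their contragredients when there is a form. It holds
already for chains: iterated poles at two lines enter antisymmetrically (`pole_poleFaces`), hence
satisfy a cocycle relation (`pole_pole_cocycle`), and the mixed terms cancel
(`suspension_suspension_of_lines`, `suspension_suspension_of_hyperplanes`). Determinants and
characteristic play no role, since `g` and `h` are products of transvections.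
-/

/-! ### Inner automorphisms act trivially on group homology -/

namespace groupHomology

open CategoryTheory Limits

variable {k G H : Type u} [CommRing k] [Group G] [Group H]

/-- The action of `g` on a representation `A`, as a morphism from `A` to its restriction along
conjugation by `g`. -/
noncomputable def conjAction (A : Rep.{u} k G) (g : G) :
    A ⟶ Rep.res (MulAut.conj g).toMonoidHom A :=
  Rep.ofHom
    { toLinearMap := A.ρ g
      isIntertwining' := fun h => by
        apply LinearMap.ext
        intro a
        change A.ρ g (A.ρ h a) = A.ρ (g * h * g⁻¹) (A.ρ g a)
        simp only [← Module.End.mul_apply, ← map_mul, inv_mul_cancel_right] }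

lemma chainsMap_conjAction_naturality {A B : Rep.{u} k G} (φ : A ⟶ B) (g : G) :
    chainsMap (MonoidHom.id G) φ ≫ chainsMap (MulAut.conj g).toMonoidHom (conjAction B g) =
      chainsMap (MulAut.conj g).toMonoidHom (conjAction A g) ≫ chainsMap (MonoidHom.id G) φ := by
  rw [← chainsMap_comp, ← chainsMap_comp]
  refine chainsMap_congr rfl ?_
  apply LinearMap.ext
  intro a
  exact (Rep.hom_comm_apply φ g a).symm

/-- Shapiro's lemma for the trivial subgroup: induced modules are acyclic. -/
lemma isZero_ind_bot (A : Rep.{u} k (⊥ : Subgroup G)) (n : ℕ) :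
    IsZero (groupHomology (Rep.ind (⊥ : Subgroup G).subtype A) (n + 1)) := by
  classical
  exact (isZero_groupHomology_succ_of_subsingleton A n).of_iso (indIso ⊥ A (n + 1))

lemma exists_epi_of_acyclic (A : Rep.{u} k G) : ∃ (P : Rep.{u} k G) (p : P ⟶ A),
    Epi p ∧ ∀ n, IsZero (groupHomology P (n + 1)) := by
  refine ⟨_, (Rep.indResHomEquiv (⊥ : Subgroup G).subtype
    (Rep.res (⊥ : Subgroup G).subtype A) A).symm (𝟙 _), ?_, isZero_ind_bot _⟩
  rw [Rep.epi_iff_surjective]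
  intro a
  refine ⟨Representation.IndV.mk _ _ 1 a, ?_⟩
  simp

/-- Conjugation by `g` together with the action of `g` induces the identity on homology. This is
proved by dimension shifting along a presentation by an acyclic module. -/
lemma map_conjAction (A : Rep.{u} k G) (g : G) (n : ℕ) :
    map (MulAut.conj g).toMonoidHom (conjAction A g) n = 𝟙 _ := by
  induction n generalizing A with
  | zero =>
    rw [← cancel_epi (H0π A), H0π_comp_map, Category.comp_id, ← coinvariantsMk_comp_H0Iso_inv,
      ← Category.assoc]
    congr 1
    apply ModuleCat.hom_ext
    apply LinearMap.ext
    intro a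
    exact (Representation.Coinvariants.mk_eq_iff A.ρ).2
      (Representation.Coinvariants.sub_mem_ker g a)
  | succ n ih =>
    obtain ⟨P, p, hp, hP⟩ := exists_epi_of_acyclic A
    let X : ShortComplex (Rep.{u} k G) := ShortComplex.mk (kernel.ι p) p (kernel.condition p)
    have hX : X.ShortExact :=
      { exact := ShortComplex.exact_kernel p }
    have := mono_δ_of_isZero hX n (hP n)
    let η : X.map (chainsFunctor k G) ⟶ X.map (chainsFunctor k G) :=
      { τ₁ := chainsMap _ (conjAction X.X₁ g)
        τ₂ := chainsMap _ (conjAction X.X₂ g)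
        τ₃ := chainsMap _ (conjAction X.X₃ g)
        comm₁₂ := (chainsMap_conjAction_naturality _ g).symm
        comm₂₃ := (chainsMap_conjAction_naturality _ g).symm }
    have key := HomologicalComplex.HomologySequence.δ_naturality η (map_chainsFunctor_shortExact hX)
      (map_chainsFunctor_shortExact hX) (n + 1) n rfl
    rw [← cancel_mono (δ hX (n + 1) n rfl)]
    refine key.symm.trans ?_
    exact (congrArg (δ hX (n + 1) n rfl ≫ ·) (ih X.X₁)).trans
      ((Category.comp_id _).trans (Category.id_comp _).symm)

/-- Pushing a map of pairs `(f, φ)` forward by an element that centralizes the image of `f` does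
not change the induced map on homology. -/
lemma map_eq_of_centralizes {A : Rep.{u} k G} {B : Rep.{u} k H} (f : G →* H)
    (φ ψ : A ⟶ Rep.res f B) (h : H) (hf : ∀ x, h * f x = f x * h)
    (hψ : ∀ a, ψ.hom a = B.ρ h (φ.hom a)) (n : ℕ) : map f φ n = map f ψ n := by
  have hcomp : (MulAut.conj h).toMonoidHom.comp f = f := MonoidHom.ext fun x => by
    change h * f x * h⁻¹ = f x
    rw [hf, mul_inv_cancel_right]
  calc map f φ n = map f φ n ≫ map (MulAut.conj h).toMonoidHom (conjAction B h) n := by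
        rw [map_conjAction, Category.comp_id]
    _ = map ((MulAut.conj h).toMonoidHom.comp f)
          (φ ≫ (Rep.resFunctor f).map (conjAction B h)) n := (map_comp _ _ _ _ n).symm
    _ = map f ψ n := map_congr hcomp (LinearMap.ext fun a => (hψ a).symm) n

lemma chainsMap_add {A : Rep.{u} k G} {B : Rep.{u} k H} (f : G →* H) (φ ψ : A ⟶ Rep.res f B) :
    chainsMap f (φ + ψ) = chainsMap f φ + chainsMap f ψ := by
  refine HomologicalComplex.hom_ext _ _ fun i => inhomogeneousChains.ext fun g => ?_
  rw [HomologicalComplex.add_f_apply, Preadditive.comp_add, lsingle_comp_chainsMap_f,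
    lsingle_comp_chainsMap_f, lsingle_comp_chainsMap_f]
  apply ModuleCat.hom_ext
  apply LinearMap.ext
  intro a
  exact Finsupp.single_add _ _ _

lemma map_add {A : Rep.{u} k G} {B : Rep.{u} k H} (f : G →* H) (φ ψ : A ⟶ Rep.res f B) (n : ℕ) :
    map f (φ + ψ) n = map f φ n + map f ψ n := by
  rw [map, chainsMap_add]
  exact HomologicalComplex.homologyMap_add _ _ n

/-- An equivariant map that is the sum of two of its translates by elements centralizing the image
of `f` induces zero on homology. -/
lemma map_eq_zero_of_eq_add_translates {A : Rep.{u} k G} {B : Rep.{u} k H} (f : G →* H)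
    (φ : A ⟶ Rep.res f B) (h₁ h₂ : H) (hf₁ : ∀ x, h₁ * f x = f x * h₁)
    (hf₂ : ∀ x, h₂ * f x = f x * h₂)
    (hφ : ∀ a, φ.hom a = B.ρ h₁ (φ.hom a) + B.ρ h₂ (φ.hom a)) (n : ℕ) : map f φ n = 0 := by
  have translate : ∀ h : H, (∀ x, h * f x = f x * h) →
      ∃ ψ : A ⟶ Rep.res f B, ∀ a, ψ.hom a = B.ρ h (φ.hom a) := by
    intro h hf
    refine ⟨Rep.ofHom
      { toLinearMap := B.ρ h ∘ₗ φ.hom.toLinearMap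
        isIntertwining' := fun x => LinearMap.ext fun a => ?_ }, fun a => rfl⟩
    change B.ρ h (φ.hom (A.ρ x a)) = B.ρ (f x) (B.ρ h (φ.hom a))
    rw [Rep.hom_comm_apply]
    change B.ρ h (B.ρ (f x) _) = _
    simp only [← Module.End.mul_apply, ← map_mul, hf]
  obtain ⟨ψ₁, hψ₁⟩ := translate h₁ hf₁
  obtain ⟨ψ₂, hψ₂⟩ := translate h₂ hf₂
  have hsum : φ = ψ₁ + ψ₂ := by
    apply Rep.hom_ext
    ext a
    exact (hφ a).trans (congrArg₂ _ (hψ₁ a) (hψ₂ a)).symm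
  have h := congrArg (fun θ => map f θ n) hsum
  simp only [map_add, ← map_eq_of_centralizes f φ ψ₁ h₁ hf₁ hψ₁,
    ← map_eq_of_centralizes f φ ψ₂ h₂ hf₂ hψ₂] at h
  exact left_eq_add.1 h

end groupHomology

/-! ### Relations between suspensions of chains -/

namespace OrderComplex

variable {α : Type*} (R : Type*) [CommRing R]

lemma linearMap_ext_single {M : Type*} [AddCommGroup M] [Module R M]
    {S T : (List α →₀ R) →ₗ[R] M} (h : ∀ l, S (Finsupp.single l 1) = T (Finsupp.single l 1)) :
    S = T :=
  Finsupp.lhom_ext' fun l => LinearMap.ext_ring (h l)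

lemma poleFaces_congr [Max α] {p q : α} (l : List α) (b : α)
    (h : ∀ x ∈ b :: l, x ⊔ p = x ⊔ q) : poleFaces R p b l = poleFaces R q b l := by
  unfold poleFaces
  refine Finset.sum_congr rfl fun j _ => ?_
  rw [List.map_congr_left fun x hx => h x (List.mem_of_mem_drop hx)]

variable [SemilatticeSup α]

/-- For `p ≤ e`, the sum over `0 ≤ i ≤ j ≤ d` of the chains
`(x_1 < ⋯ < x_i < x_i ⊔ p < ⋯ < x_j ⊔ p < x_j ⊔ e < ⋯ < x_d ⊔ e)` with sign `(-1) ^ (i + j)`,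
where `x_0 = b`; it is defined by recursion on the chain, splitting off the terms with `i = 0`. -/
noncomputable def doublePole (p e : α) : α → List α → (List α →₀ R)
  | b, [] => Finsupp.single [b ⊔ p, b ⊔ e] 1
  | b, x :: l => consMap R (b ⊔ p) (poleFaces R e (b ⊔ p) ((x :: l).map (· ⊔ p))) +
      consMap R x (doublePole p e x l)

/-- An iterated pole is antisymmetric in `p` and `q`: in the `j`-th term of the inner sum, the outer
sum inserts `p` either before or after the place where `q` was inserted. -/
lemma pole_poleFaces (p q b : α) (l : List α) :
    pole R p b (poleFaces R q b l) =
      doublePole R p (p ⊔ q) b l - doublePole R q (p ⊔ q) b l := by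
  have hq : ∀ x : α, x ⊔ q ⊔ p = x ⊔ (p ⊔ q) := fun x => by rw [sup_assoc, sup_comm q p]
  have hpe : ∀ x : α, x ⊔ p ⊔ (p ⊔ q) = x ⊔ (p ⊔ q) := fun x => by
    rw [sup_assoc, ← sup_assoc p p q, sup_idem]
  have hqe : ∀ x : α, x ⊔ q ⊔ (p ⊔ q) = x ⊔ (p ⊔ q) := fun x => by
    rw [sup_comm p q, sup_assoc, ← sup_assoc q q p, sup_idem]
  induction l generalizing b with
  | nil => simp [poleFaces_nil, poleFaces_cons, doublePole, hq]
  | cons x l ih =>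
    have h1 : poleFaces R p (b ⊔ q) ((x :: l).map (· ⊔ q)) =
        poleFaces R (p ⊔ q) (b ⊔ q) ((x :: l).map (· ⊔ q)) := by
      refine poleFaces_congr R _ _ fun y hy => ?_
      rw [← List.map_cons (f := (· ⊔ q))] at hy
      obtain ⟨z, -, rfl⟩ := List.mem_map.1 hy
      simp only [hq, hqe]
    have h2 : vertexMap R (· ⊔ p) (poleFaces R q x l) =
        poleFaces R (p ⊔ q) (x ⊔ p) (l.map (· ⊔ p)) := by
      rw [← pole_single, vertexMap_pole R _ (fun y z => sup_sup_distrib_right y z p),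
        vertexMap_single, pole_single, sup_comm q p]
    rw [poleFaces_cons, map_sub, pole_single, poleFaces_cons, h1, pole_consMap, ih, h2, doublePole,
      doublePole]
    simp only [poleFaces_cons R (p ⊔ q) (b ⊔ p), map_sub, consMap_single, List.map_cons,
      List.map_map, Function.comp_def, hq, hpe]
    abel

/-- The cocycle relation for iterated poles at `p`, `r` and `q`, as for three lines that pairwise span
the same plane. -/
lemma pole_pole_cocycle (p q r b : α) (h₁ : p ⊔ r = p ⊔ q) (h₂ : r ⊔ q = p ⊔ q) :
    pole R p b ∘ₗ pole R q b = pole R p b ∘ₗ pole R r b + pole R r b ∘ₗ pole R q b := by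
  refine linearMap_ext_single R fun l => ?_
  simp only [LinearMap.add_apply, LinearMap.comp_apply, pole_single, pole_poleFaces, h₁, h₂]
  abel

lemma pole_pole_antisymm (p q b : α) :
    pole R p b ∘ₗ pole R q b = - pole R q b ∘ₗ pole R p b := by
  refine linearMap_ext_single R fun l => ?_
  simp only [LinearMap.neg_apply, LinearMap.comp_apply, pole_single, pole_poleFaces, sup_comm q p]
  abel

/-- The analogue of the cocycle relation when the plane is replaced by the poles `w`, `p` and
`w ⊔ p`, where `w` and `w ⊔ p` are top vertices. -/
lemma topPole_topPole_sup (p w b : α) :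
    topPole R (w ⊔ p) ∘ₗ topPole R w =
      pole R p b ∘ₗ topPole R w + topPole R (w ⊔ p) ∘ₗ pole R p b := by
  refine linearMap_ext_single R fun l => ?_
  simp only [LinearMap.add_apply, LinearMap.comp_apply]
  induction l generalizing b with
  | nil =>
    simp only [topPole_single, pole_single, poleFaces_nil, poleFaces_cons,
      consMap_single, List.length_nil, List.length_cons, List.nil_append, List.cons_append,
      List.map_cons, List.map_nil, pow_zero, one_smul, zero_add, pow_one, neg_smul]
    abel
  | cons x l ih =>
    rw [← consMap_single]
    simp only [topPole_consMap, map_neg, pole_consMap, map_sub, neg_neg, vertexMap_topPole, ih x,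
      map_add]
    abel

/-- The splitting of a double suspension whose poles are lines, where `l` is a third line of the plane
of `p` and `q`, and `m` is a third line of the plane of `p'` and `q'`. The two terms that
mix `l` and `m` cancel by antisymmetry. -/
lemma suspension_suspension_of_lines {p p' q q' l m : α} (b : α) (hpl : p ⊔ l = p ⊔ q)
    (hlq : l ⊔ q = p ⊔ q) (hpm : p' ⊔ m = p' ⊔ q') (hmq : m ⊔ q' = p' ⊔ q') :
    (pole R p b - pole R p' b) ∘ₗ (pole R q b - pole R q' b) =
      (pole R p b - pole R m b) ∘ₗ (pole R l b - pole R q' b) +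
        (pole R l b - pole R p' b) ∘ₗ (pole R q b - pole R m b) := by
  simp only [LinearMap.sub_comp, LinearMap.comp_sub]
  rw [pole_pole_cocycle R p q l b hpl hlq, pole_pole_cocycle R p' q' m b hpm hmq,
    pole_pole_antisymm R m l b]
  abel

/-- The splitting of a double suspension with poles `p`, `v` and `q`, `w`, where `v` and `w` are top
vertices and `l` is a third line of the plane of `p` and `q`. -/
lemma suspension_suspension_of_hyperplanes {p q l : α} (b w v : α) (hpl : p ⊔ l = p ⊔ q)
    (hlq : l ⊔ q = p ⊔ q) :
    (pole R p b - topPole R v) ∘ₗ (pole R q b - topPole R w) =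
      (pole R p b - topPole R (w ⊔ l)) ∘ₗ (pole R l b - topPole R w) +
        (pole R l b - topPole R v) ∘ₗ (pole R q b - topPole R w) := by
  simp only [LinearMap.sub_comp, LinearMap.comp_sub]
  rw [pole_pole_cocycle R p q l b hpl hlq, topPole_topPole_sup R l w b]
  abel

end OrderComplex

/-! ### Elementary automorphisms -/

namespace ClassicalFamily

open OrderComplex

variable {F : Type u} [Field F]

section Elementary

variable {ι : Type*} [DecidableEq ι]

/-- The elementary automorphism of `F^ι` that adds `t` times the `j`-th coordinate to the `i`-th
coordinate; it sends the `j`-th basis vector `e_j` to `e_j + t e_i` and fixes the others. -/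
def elementary {i j : ι} (hij : i ≠ j) (t : F) : (ι → F) ≃ₗ[F] (ι → F) :=
  LinearEquiv.transvection (f := LinearMap.proj j) (v := t • Pi.single i 1)
    (by simp [Pi.single_eq_of_ne hij.symm])

lemma elementary_apply {i j : ι} (hij : i ≠ j) (t : F) (v : ι → F) :
    elementary hij t v = v + v j • t • Pi.single i 1 := rfl

lemma elementary_apply_of_eq_zero {i j : ι} (hij : i ≠ j) (t : F) {v : ι → F} (hv : v j = 0) :
    elementary hij t v = v := by
  rw [elementary_apply, hv, zero_smul, add_zero]

lemma elementary_apply_single {i j : ι} (hij : i ≠ j) (t : F) :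
    elementary hij t (Pi.single j 1) = Pi.single j 1 + t • Pi.single i 1 := by
  rw [elementary_apply, Pi.single_eq_same, one_smul]

lemma elementary_apply_single_of_ne {i j k : ι} (hij : i ≠ j) (t : F) (hk : k ≠ j) :
    elementary hij t (Pi.single k 1) = Pi.single k 1 :=
  elementary_apply_of_eq_zero hij t (Pi.single_eq_of_ne hk.symm _)

lemma elementary_apply_coord_of_ne {i j k : ι} (hij : i ≠ j) (t : F) (hk : k ≠ i) (v : ι → F) :
    elementary hij t v k = v k := by
  simp [elementary_apply, Pi.single_eq_of_ne hk]

lemma elementary_comm {i j : ι} (hij : i ≠ j) (t : F) {T : (ι → F) ≃ₗ[F] (ι → F)}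
    (hi : T (Pi.single i 1) = Pi.single i 1) (hj : ∀ v, T v j = v j) :
    elementary hij t * T = T * elementary hij t := by
  apply LinearEquiv.ext
  intro v
  change elementary hij t (T v) = T (elementary hij t v)
  rw [elementary_apply, elementary_apply, hj, map_add, map_smul, map_smul, hi]

lemma elementary_mem_ker_det {i j : ι} (hij : i ≠ j) (t : F) :
    elementary hij t ∈ (LinearEquiv.det : ((ι → F) ≃ₗ[F] (ι → F)) →* Fˣ).ker :=
  LinearEquiv.transvection.det_eq_one _

variable {κ : Type*} {a b : κ → ι}

/-- For two families of basis vectors `a` and `b` that are dual to each other, the elementary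
automorphism `a_k ↦ a_k + a_j` together with its contragredient `b_j ↦ b_j - b_k`. -/
def leviElementary (ha : a.Injective) (hb : b.Injective) {j k : κ} (hjk : j ≠ k) :
    (ι → F) ≃ₗ[F] (ι → F) :=
  elementary (ha.ne hjk) 1 * elementary (hb.ne hjk.symm) (-1)

variable (ha : a.Injective) (hb : b.Injective) (hab : ∀ x y, a x ≠ b y)

lemma leviElementary_mem_ker_det {j k : κ} (hjk : j ≠ k) :
    leviElementary ha hb hjk ∈ (LinearEquiv.det : ((ι → F) ≃ₗ[F] (ι → F)) →* Fˣ).ker :=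
  mul_mem (elementary_mem_ker_det _ _) (elementary_mem_ker_det _ _)

lemma leviElementary_apply_of_eq_zero {j k : κ} (hjk : j ≠ k) {v : ι → F} (h₁ : v (a k) = 0)
    (h₂ : v (b j) = 0) : leviElementary ha hb hjk v = v := by
  rw [leviElementary, LinearEquiv.mul_apply, elementary_apply_of_eq_zero _ _ h₂,
    elementary_apply_of_eq_zero _ _ h₁]

include hab in
lemma leviElementary_apply {j k : κ} (hjk : j ≠ k) (v : ι → F) :
    leviElementary ha hb hjk v =
      v + (v (a k) • Pi.single (a j) 1 - v (b j) • Pi.single (b k) 1) := by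
  have h : elementary (hb.ne hjk.symm) (-1) v (a k) = v (a k) :=
    elementary_apply_coord_of_ne _ _ (hab k k) v
  rw [leviElementary, LinearEquiv.mul_apply, elementary_apply (ha.ne hjk), h,
    elementary_apply, one_smul, neg_smul, smul_neg, one_smul]
  abel

include hab in
lemma leviElementary_source {j k : κ} (hjk : j ≠ k) :
    leviElementary ha hb hjk (Pi.single (a k) 1 : ι → F) =
      Pi.single (a k) 1 + Pi.single (a j) 1 := by
  rw [leviElementary_apply ha hb hab, Pi.single_eq_same, Pi.single_eq_of_ne (hab k j).symm,
    one_smul, zero_smul, sub_zero]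

include hab in
lemma leviElementary_target {j k : κ} (hjk : j ≠ k) :
    leviElementary ha hb hjk (Pi.single (a j) 1 : ι → F) = Pi.single (a j) 1 := by
  rw [leviElementary_apply ha hb hab, Pi.single_eq_of_ne (ha.ne hjk.symm),
    Pi.single_eq_of_ne (hab j j).symm, zero_smul, zero_smul, sub_zero, add_zero]

include hab in
lemma leviElementary_dual_source {j k : κ} (hjk : j ≠ k) :
    leviElementary ha hb hjk (Pi.single (b j) 1 : ι → F) =
      Pi.single (b j) 1 - Pi.single (b k) 1 := by
  rw [leviElementary_apply ha hb hab, Pi.single_eq_same, Pi.single_eq_of_ne (hab k j),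
    one_smul, zero_smul, zero_sub, sub_eq_add_neg]

include hab in
lemma leviElementary_dual_target {j k : κ} (hjk : j ≠ k) :
    leviElementary ha hb hjk (Pi.single (b k) 1 : ι → F) = Pi.single (b k) 1 := by
  rw [leviElementary_apply ha hb hab, Pi.single_eq_of_ne (hab k k),
    Pi.single_eq_of_ne (hb.ne hjk), zero_smul, zero_smul, sub_zero, add_zero]

include hab in
/-- The pairing of the two families of coordinates is invariant; the symplectic and the quadratic
forms are built from it. -/
lemma sum_leviElementary [Fintype κ] {j k : κ} (hjk : j ≠ k) (v w : ι → F) :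
    ∑ x, leviElementary ha hb hjk v (a x) * leviElementary ha hb hjk w (b x) =
      ∑ x, v (a x) * w (b x) := by
  classical
  have h₁ : ∀ x, leviElementary ha hb hjk v (a x) = v (a x) + if x = j then v (a k) else 0 := by
    intro x
    rw [leviElementary_apply ha hb hab]
    simp [Pi.single_apply, ha.eq_iff, hab]
  have h₂ : ∀ x, leviElementary ha hb hjk w (b x) = w (b x) - if x = k then w (b j) else 0 := by
    intro x
    rw [leviElementary_apply ha hb hab]
    simp [Pi.single_apply, hb.eq_iff, (hab _ _).symm, sub_eq_add_neg]
  simp only [h₁, h₂, add_mul, mul_sub, Finset.sum_add_distrib, Finset.sum_sub_distrib, ite_mul,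
    mul_ite, zero_mul, mul_zero, Finset.sum_ite_eq', Finset.mem_univ, if_true]
  simp [hjk.symm]

end Elementary

section Spans

variable {V : Type*} [AddCommGroup V] [Module F V] (x y : V)

lemma span_singleton_neg : Submodule.span F {-x} = Submodule.span F {x} := by
  rw [← Set.neg_singleton, Submodule.span_neg]

lemma span_sup_span_add :
    Submodule.span F {x} ⊔ Submodule.span F {x + y} =
      Submodule.span F {x} ⊔ Submodule.span F {y} := by
  apply le_antisymm <;>
    refine sup_le le_sup_left ((Submodule.span_singleton_le_iff_mem _ _).2 ?_)
  · exact add_mem (Submodule.mem_sup_left (Submodule.mem_span_singleton_self x))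
      (Submodule.mem_sup_right (Submodule.mem_span_singleton_self y))
  · have h := sub_mem (Submodule.mem_sup_right (Submodule.mem_span_singleton_self (R := F) (x + y)))
      (Submodule.mem_sup_left (Submodule.mem_span_singleton_self (R := F) x))
    rwa [add_sub_cancel_left] at h

lemma span_add_sup_span :
    Submodule.span F {x + y} ⊔ Submodule.span F {y} =
      Submodule.span F {x} ⊔ Submodule.span F {y} := by
  rw [sup_comm, add_comm, span_sup_span_add, sup_comm]

lemma span_sup_span_sub :
    Submodule.span F {x} ⊔ Submodule.span F {x - y} =
      Submodule.span F {x} ⊔ Submodule.span F {y} := by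
  rw [sub_eq_add_neg, span_sup_span_add, span_singleton_neg]

lemma span_sub_sup_span :
    Submodule.span F {x - y} ⊔ Submodule.span F {y} =
      Submodule.span F {x} ⊔ Submodule.span F {y} := by
  rw [sup_comm, ← neg_sub, span_singleton_neg, span_sup_span_sub, sup_comm]

end Spans

section Lines

variable {c : ClassicalFamily} {n : ℕ}

lemma incl_single (i : c.Idx n) :
    incl F c n (Pi.single i 1) = Pi.single (c.shift n i) 1 := by
  funext k
  by_cases hk : k ∈ Set.range (c.shift n)
  · obtain ⟨j, rfl⟩ := hk
    rw [incl_shift]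
    simp only [Pi.single_apply, (c.shift_injective n).eq_iff]
  · rw [incl_of_notMem c n _ k hk, Pi.single_eq_of_ne]
    rintro rfl
    exact hk ⟨i, rfl⟩

lemma map_incl_line (i : c.Idx n) :
    (line F c n i).map (incl F c n) = line F c (n + 1) (c.shift n i) := by
  rw [line, Submodule.map_span, Set.image_singleton, incl_single, line]

lemma map_line (g : c.Vec n F ≃ₗ[F] c.Vec n F) (i : c.Idx n) :
    (line F c n i).map (g : c.Vec n F →ₗ[F] c.Vec n F) =
      Submodule.span F {g (Pi.single i 1)} := by
  rw [line, Submodule.map_span, Set.image_singleton]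
  rfl

end Lines

/-! ### The double suspension on chains -/

section Double

variable (R : Type u) [CommRing R]

/-- The inclusion `V_n → V_{n+2}`. -/
noncomputable abbrev incl₂ (c : ClassicalFamily) (n : ℕ) : c.Vec n F →ₗ[F] c.Vec (n + 2) F :=
  incl F c (n + 1) ∘ₗ incl F c n

variable {c : ClassicalFamily} {n : ℕ}

lemma vertexMap_vertexMap_incl (z : List (Submodule F (c.Vec n F)) →₀ R) :
    vertexMap R (Submodule.map (incl F c (n + 1))) (vertexMap R (Submodule.map (incl F c n)) z) =
      vertexMap R (Submodule.map (incl₂ c n)) z := by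
  simp only [OrderComplex.vertexMap, Finsupp.lmapDomain_apply, ← Finsupp.mapDomain_comp]
  congr 1
  funext l
  simp only [Function.comp_apply, List.map_map]
  congr 1
  funext U
  exact (Submodule.map_comp _ _ U).symm

lemma vertexMap_vertexMap_incl₂ {g : c.Vec (n + 2) F ≃ₗ[F] c.Vec (n + 2) F}
    (hg : ∀ v, g (incl₂ c n v) = incl₂ c n v) (z : List (Submodule F (c.Vec n F)) →₀ R) :
    vertexMap R (Submodule.map (g : c.Vec (n + 2) F →ₗ[F] c.Vec (n + 2) F))
      (vertexMap R (Submodule.map (incl₂ c n)) z) =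
      vertexMap R (Submodule.map (incl₂ c n)) z := by
  have : (g : c.Vec (n + 2) F →ₗ[F] c.Vec (n + 2) F) ∘ₗ incl₂ c n = incl₂ c n :=
    LinearMap.ext hg
  simp only [OrderComplex.vertexMap, Finsupp.lmapDomain_apply, ← Finsupp.mapDomain_comp]
  congr 1
  funext l
  simp only [Function.comp_apply, List.map_map]
  congr 1
  funext U
  rw [Function.comp_apply, ← Submodule.map_comp, this]

lemma vertexMap_map_pole {V V' : Type*} [AddCommGroup V] [Module F V] [AddCommGroup V']
    [Module F V'] (f : V →ₗ[F] V') (p : Submodule F V) (z : List (Submodule F V) →₀ R) :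
    vertexMap R (Submodule.map f) (pole R p ⊥ z) =
      pole R (p.map f) ⊥ (vertexMap R (Submodule.map f) z) := by
  rw [vertexMap_pole R _ (fun U U' => Submodule.map_sup U U' f), Submodule.map_bot]

lemma reederChain_reederChain_of_lines {b₀ : c.Idx (n + 2)} {b₁ : c.Idx (n + 1)}
    (h₀ : secondPole F R c (n + 1) = pole R (line F c (n + 2) b₀) ⊥)
    (h₁ : secondPole F R c n = pole R (line F c (n + 1) b₁) ⊥)
    (z : List (Submodule F (c.Vec n F)) →₀ R) :
    reederChain F R c (n + 1) (reederChain F R c n z) =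
      ((pole R (line F c (n + 2) (c.idxA (n + 1))) ⊥ - pole R (line F c (n + 2) b₀) ⊥) ∘ₗ
        (pole R (line F c (n + 2) (c.shift (n + 1) (c.idxA n))) ⊥ -
          pole R (line F c (n + 2) (c.shift (n + 1) b₁)) ⊥))
        (vertexMap R (Submodule.map (incl₂ c n)) z) := by
  simp only [reederChain, LinearMap.comp_apply, LinearMap.sub_apply, map_sub, h₀, h₁,
    vertexMap_map_pole, map_incl_line, vertexMap_vertexMap_incl]

lemma reederChain_reederChain_of_hyperplanes
    (h₀ : secondPole F R c (n + 1) = topPole R (LinearMap.range (incl F c (n + 1))))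
    (h₁ : secondPole F R c n = topPole R (LinearMap.range (incl F c n)))
    (z : List (Submodule F (c.Vec n F)) →₀ R) :
    reederChain F R c (n + 1) (reederChain F R c n z) =
      ((pole R (line F c (n + 2) (c.idxA (n + 1))) ⊥ -
          topPole R (LinearMap.range (incl F c (n + 1)))) ∘ₗ
        (pole R (line F c (n + 2) (c.shift (n + 1) (c.idxA n))) ⊥ -
          topPole R (LinearMap.range (incl₂ (F := F) c n))))
        (vertexMap R (Submodule.map (incl₂ c n)) z) := by
  simp only [reederChain, LinearMap.comp_apply, LinearMap.sub_apply, map_sub, h₀, h₁,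
    vertexMap_map_pole, vertexMap_topPole, map_incl_line, vertexMap_vertexMap_incl,
    LinearMap.range_comp]

end Double

end ClassicalFamily

namespace ClassicalFamily

open OrderComplex

variable {F : Type u} [Field F] (R : Type u) [CommRing R] {c : ClassicalFamily} {n : ℕ}

/-! ### Elements centralizing the image of `G_n` in `G_{n+2}` -/

/-- An index of the basis of `V_{n+2}` that does not come from `V_n`. -/
def IsNew₂ (c : ClassicalFamily) (n : ℕ) (i : c.Idx (n + 2)) : Prop :=
  i ∉ Set.range (c.shift (n + 1) ∘ c.shift n)

lemma isNew₂_of_notMem {i : c.Idx (n + 2)} (hi : i ∉ Set.range (c.shift (n + 1))) :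
    IsNew₂ c n i := fun ⟨j, hj⟩ => hi ⟨c.shift n j, hj⟩

lemma isNew₂_shift {i : c.Idx (n + 1)} (hi : i ∉ Set.range (c.shift n)) :
    IsNew₂ c n (c.shift (n + 1) i) := fun ⟨j, hj⟩ => hi ⟨j, c.shift_injective (n + 1) hj⟩

lemma IsNew₂.incl₂_apply {i : c.Idx (n + 2)} (hi : IsNew₂ c n i) (v : c.Vec n F) :
    incl₂ c n v i = 0 := by
  by_cases h : i ∈ Set.range (c.shift (n + 1))
  · obtain ⟨j, rfl⟩ := h
    rw [incl₂, LinearMap.comp_apply, incl_shift, incl_of_notMem]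
    rintro ⟨k, rfl⟩
    exact hi ⟨k, rfl⟩
  · exact incl_of_notMem c (n + 1) _ i h

lemma extendAut_single (g : c.Vec n F ≃ₗ[F] c.Vec n F) {i : c.Idx (n + 1)}
    (hi : i ∉ Set.range (c.shift n)) : extendAut c n g (Pi.single i 1) = Pi.single i 1 := by
  change extendEnd c n _ _ = _
  rw [extendEnd_apply, restr_single c n i hi, map_zero, sub_zero, map_zero, add_zero]

lemma IsNew₂.extendAut_extendAut_single {i : c.Idx (n + 2)} (hi : IsNew₂ c n i)
    (g : c.Vec n F ≃ₗ[F] c.Vec n F) :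
    extendAut c (n + 1) (extendAut c n g) (Pi.single i 1) = Pi.single i 1 := by
  by_cases h : i ∈ Set.range (c.shift (n + 1))
  · obtain ⟨j, rfl⟩ := h
    rw [← incl_single]
    refine (extendEnd_incl c (n + 1) _ _).trans (congrArg _ (extendAut_single g ?_))
    rintro ⟨k, rfl⟩
    exact hi ⟨k, rfl⟩
  · exact extendAut_single _ h

lemma IsNew₂.extendAut_extendAut_apply {i : c.Idx (n + 2)} (hi : IsNew₂ c n i)
    (g : c.Vec n F ≃ₗ[F] c.Vec n F) (v : c.Vec (n + 2) F) :
    extendAut c (n + 1) (extendAut c n g) v i = v i := by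
  by_cases h : i ∈ Set.range (c.shift (n + 1))
  · obtain ⟨j, rfl⟩ := h
    refine (extendEnd_shift c (n + 1) _ v j).trans ?_
    refine (extendEnd_of_notMem c n _ _ j ?_).trans rfl
    rintro ⟨k, rfl⟩
    exact hi ⟨k, rfl⟩
  · exact extendEnd_of_notMem c (n + 1) _ v i h

lemma elementary_extendAut_extendAut_comm {i j : c.Idx (n + 2)} (hij : i ≠ j)
    (hi : IsNew₂ c n i) (hj : IsNew₂ c n j) (t : F) (g : c.Vec n F ≃ₗ[F] c.Vec n F) :
    Commute (elementary hij t) (extendAut c (n + 1) (extendAut c n g)) :=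
  elementary_comm hij t (hi.extendAut_extendAut_single g) (hj.extendAut_extendAut_apply g)

/-- The double suspension from the building of `V_n` to that of `V_{n+2}` is, on chains, the sum of its
translates by two elements of `G_{n+2}` that centralize `G_n`. -/
def SplitsDoubleSuspension (F : Type u) [Field F] (R : Type u) [CommRing R]
    (c : ClassicalFamily) (n : ℕ) : Prop :=
  ∃ g h : c.Vec (n + 2) F ≃ₗ[F] c.Vec (n + 2) F, g ∈ group F c (n + 2) ∧ h ∈ group F c (n + 2) ∧
    (∀ x, Commute g (extendAut c (n + 1) (extendAut c n x))) ∧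
    (∀ x, Commute h (extendAut c (n + 1) (extendAut c n x))) ∧
    ∀ z : List (Submodule F (c.Vec n F)) →₀ R,
      reederChain F R c (n + 1) (reederChain F R c n z) =
        vertexMap R (Submodule.map (g : c.Vec (n + 2) F →ₗ[F] c.Vec (n + 2) F))
          (reederChain F R c (n + 1) (reederChain F R c n z)) +
        vertexMap R (Submodule.map (h : c.Vec (n + 2) F →ₗ[F] c.Vec (n + 2) F))
          (reederChain F R c (n + 1) (reederChain F R c n z))

/-- The splitting for the families with a form: `a` and `b` enumerate the hyperbolic basis vectors. -/
lemma splits_of_lines (a b : Fin (n + 2) → c.Idx (n + 2)) (ha : a.Injective) (hb : b.Injective)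
    (hab : ∀ x y, a x ≠ b y) (b₀ : c.Idx (n + 2)) (b₁ : c.Idx (n + 1))
    (ha₀ : a 0 = c.idxA (n + 1)) (ha₁ : a 1 = c.shift (n + 1) (c.idxA n))
    (hb₀ : b 0 = b₀) (hb₁ : b 1 = c.shift (n + 1) b₁) (hn₀ : IsNew c (n + 1) b₀)
    (hn₁ : IsNew c n b₁)
    (h₀ : secondPole F R c (n + 1) = pole R (line F c (n + 2) b₀) ⊥)
    (h₁ : secondPole F R c n = pole R (line F c (n + 1) b₁) ⊥)
    (hmem : ∀ (j k : Fin (n + 2)) (hjk : j ≠ k),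
      (leviElementary ha hb hjk : c.Vec (n + 2) F ≃ₗ[F] c.Vec (n + 2) F) ∈ group F c (n + 2)) :
    SplitsDoubleSuspension F R c n := by
  have h01 : (0 : Fin (n + 2)) ≠ 1 := by simp
  have na₀ : IsNew₂ c n (a 0) := ha₀ ▸ isNew₂_of_notMem (isNew_idxA c _).notMem
  have na₁ : IsNew₂ c n (a 1) := ha₁ ▸ isNew₂_shift (isNew_idxA c _).notMem
  have nb₀ : IsNew₂ c n (b 0) := hb₀ ▸ isNew₂_of_notMem hn₀.notMem
  have nb₁ : IsNew₂ c n (b 1) := hb₁ ▸ isNew₂_shift hn₁.notMem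
  have key := suspension_suspension_of_lines R (⊥ : Submodule F (c.Vec (n + 2) F))
    (span_sup_span_add (F := F) (Pi.single (a 0) 1) (Pi.single (a 1) 1))
    (span_add_sup_span (F := F) (Pi.single (a 0) 1) (Pi.single (a 1) 1))
    (span_sup_span_sub (F := F) (Pi.single (b 0) 1) (Pi.single (b 1) 1))
    (span_sub_sup_span (F := F) (Pi.single (b 0) 1) (Pi.single (b 1) 1))
  have comm : ∀ (j k : Fin (n + 2)) (hjk : j ≠ k), IsNew₂ c n (a j) → IsNew₂ c n (a k) →
      IsNew₂ c n (b j) → IsNew₂ c n (b k) → ∀ x : c.Vec n F ≃ₗ[F] c.Vec n F,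
      Commute (leviElementary ha hb hjk) (extendAut c (n + 1) (extendAut c n x)) :=
    fun j k hjk haj hak hbj hbk x => Commute.mul_left
      (elementary_extendAut_extendAut_comm _ haj hak _ x)
      (elementary_extendAut_extendAut_comm _ hbk hbj _ x)
  refine ⟨leviElementary ha hb h01, leviElementary ha hb h01.symm, hmem _ _ _, hmem _ _ _,
    comm _ _ _ na₀ na₁ nb₀ nb₁, comm _ _ _ na₁ na₀ nb₁ nb₀, fun z => ?_⟩
  rw [reederChain_reederChain_of_lines R h₀ h₁, ← ha₀, ← ha₁, ← hb₀, ← hb₁]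
  simp only [LinearMap.comp_apply, LinearMap.sub_apply, map_sub, vertexMap_map_pole, map_line]
  rw [vertexMap_vertexMap_incl₂ R fun v => leviElementary_apply_of_eq_zero ha hb h01
      (na₁.incl₂_apply v) (nb₀.incl₂_apply v),
    vertexMap_vertexMap_incl₂ R fun v => leviElementary_apply_of_eq_zero ha hb h01.symm
      (na₀.incl₂_apply v) (nb₁.incl₂_apply v)]
  have key' := LinearMap.congr_fun key (vertexMap R (Submodule.map (incl₂ c n)) z)
  simp only [LinearMap.comp_apply, LinearMap.add_apply, LinearMap.sub_apply, map_sub] at key'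
  simp only [leviElementary_source ha hb hab, leviElementary_target ha hb hab,
    leviElementary_dual_source ha hb hab, leviElementary_dual_target ha hb hab, line]
  rw [← neg_sub (Pi.single (b 0) 1 : c.Vec (n + 2) F), span_singleton_neg,
    add_comm (Pi.single (a 1) 1 : c.Vec (n + 2) F)]
  exact key'

/-- The splitting for the general and special linear groups. -/
lemma splits_of_hyperplanes (hc : ∀ i : c.Idx (n + 1), i ∉ Set.range (c.shift n) → i = c.idxA n)
    (h₀ : secondPole F R c (n + 1) = topPole R (LinearMap.range (incl F c (n + 1))))
    (h₁ : secondPole F R c n = topPole R (LinearMap.range (incl F c n)))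
    (hmem : ∀ {i j : c.Idx (n + 2)} (hij : i ≠ j),
      (elementary hij 1 : c.Vec (n + 2) F ≃ₗ[F] c.Vec (n + 2) F) ∈ group F c (n + 2)) :
    SplitsDoubleSuspension F R c n := by
  have hp := (isNew_idxA c (n + 1)).notMem
  have nq : IsNew₂ c n (c.shift (n + 1) (c.idxA n)) := isNew₂_shift (isNew_idxA c n).notMem
  obtain ⟨p, hp'⟩ : ∃ p, p = c.idxA (n + 1) := ⟨_, rfl⟩
  obtain ⟨q, hq⟩ : ∃ q, q = c.shift (n + 1) (c.idxA n) := ⟨_, rfl⟩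
  rw [← hp'] at hp
  rw [← hq] at nq
  have hpq : p ≠ q := fun h => hp ⟨c.idxA n, hq.symm.trans h.symm⟩
  have np : IsNew₂ c n p := isNew₂_of_notMem hp
  -- the hyperplane `W` is spanned by the image of `V_n` and the second basis vector
  have hW : LinearMap.range (incl F c (n + 1)) =
      LinearMap.range (incl₂ (F := F) c n) ⊔ line F c (n + 2) q := by
    apply le_antisymm
    · rintro _ ⟨v, rfl⟩
      have hv : v = incl F c n (restr F c n v) + v (c.idxA n) • Pi.single (c.idxA n) 1 := by
        funext k
        by_cases hk : k ∈ Set.range (c.shift n)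
        · obtain ⟨j, rfl⟩ := hk
          rw [Pi.add_apply, incl_shift, Pi.smul_apply,
            Pi.single_eq_of_ne fun h => (isNew_idxA c n).notMem ⟨j, h⟩, smul_zero, add_zero]
          rfl
        · rw [Pi.add_apply, incl_of_notMem c n _ k hk, zero_add, hc k hk, Pi.smul_apply,
            Pi.single_eq_same, smul_eq_mul, mul_one]
      rw [hv, map_add, map_smul, incl_single, ← hq]
      exact Submodule.add_mem_sup ⟨restr F c n v, rfl⟩ (mem_line.2 ⟨_, rfl⟩)
    · refine sup_le (LinearMap.range_comp_le_range _ _) ?_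
      rw [hq, ← map_incl_line]
      exact LinearMap.map_le_range
  have hfix : ∀ {i j : c.Idx (n + 2)} (hij : i ≠ j), IsNew₂ c n j → ∀ v : c.Vec n F,
      elementary hij 1 (incl₂ c n v) = incl₂ c n v := fun hij hj v =>
    elementary_apply_of_eq_zero hij 1 (hj.incl₂_apply v)
  have hrange : ∀ {i j : c.Idx (n + 2)} (hij : i ≠ j), IsNew₂ c n j →
      (LinearMap.range (incl₂ (F := F) c n)).map
        (elementary hij 1 : c.Vec (n + 2) F ≃ₗ[F] c.Vec (n + 2) F).toLinearMap =
      LinearMap.range (incl₂ (F := F) c n) := by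
    intro i j hij hj
    rw [← LinearMap.range_comp]
    exact congrArg _ (LinearMap.ext (hfix hij hj))
  have key := suspension_suspension_of_hyperplanes R (⊥ : Submodule F (c.Vec (n + 2) F))
    (LinearMap.range (incl₂ (F := F) c n)) (LinearMap.range (incl F c (n + 1)))
    (span_sup_span_add (F := F) (Pi.single p 1) (Pi.single q 1))
    (span_add_sup_span (F := F) (Pi.single p 1) (Pi.single q 1))
  refine ⟨elementary hpq 1, elementary hpq.symm 1, hmem _, hmem _,
    elementary_extendAut_extendAut_comm _ np nq _, elementary_extendAut_extendAut_comm _ nq np _,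
    fun z => ?_⟩
  rw [reederChain_reederChain_of_hyperplanes R h₀ h₁, ← hp', ← hq]
  simp only [LinearMap.comp_apply, LinearMap.sub_apply, map_sub, vertexMap_map_pole,
    vertexMap_topPole, map_line, hrange hpq nq, hrange hpq.symm np]
  rw [vertexMap_vertexMap_incl₂ R (hfix hpq nq), vertexMap_vertexMap_incl₂ R (hfix hpq.symm np)]
  have key' := LinearMap.congr_fun key (vertexMap R (Submodule.map (incl₂ c n)) z)
  simp only [LinearMap.comp_apply, LinearMap.add_apply, LinearMap.sub_apply, map_sub] at key'
  rw [hW] at key' ⊢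
  simp only [line] at key' ⊢
  simp only [Submodule.map_sup, Submodule.map_span, Set.image_singleton, LinearEquiv.coe_coe,
    hrange hpq nq, hrange hpq.symm np,
    elementary_apply_single, elementary_apply_single_of_ne hpq _ hpq,
    elementary_apply_single_of_ne hpq.symm _ hpq.symm, one_smul]
  rw [add_comm (Pi.single q 1 : c.Vec (n + 2) F)]
  exact key'

lemma splitsDoubleSuspension (c : ClassicalFamily) (n : ℕ) : SplitsDoubleSuspension F R c n := by
  have hsum : ∀ x y : Fin (n + 2), (Sum.inl x : Fin (n + 2) ⊕ Fin (n + 2)) ≠ Sum.inr y :=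
    fun _ _ => Sum.inl_ne_inr
  have hfin : ∀ i : Fin (n + 1), i ∉ Set.range Fin.succ → i = 0 := fun i hi =>
    of_not_not fun h => hi (Fin.exists_succ_eq.2 h)
  cases c with
  | gl =>
    exact splits_of_hyperplanes R (c := gl) hfin rfl rfl (fun _ => Subgroup.mem_top _)
  | sl =>
    exact splits_of_hyperplanes R (c := sl) hfin rfl rfl
      (fun hij => elementary_mem_ker_det hij 1)
  | sp =>
    refine splits_of_lines R (c := sp) Sum.inl Sum.inr Sum.inl_injective Sum.inr_injective hsum
      (.inr 0) (.inr 0) rfl rfl rfl rfl (Or.inr rfl) (Or.inr rfl) rfl rfl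
      fun j k hjk v w => ?_
    have h : ∀ v w : Vec sp (n + 2) F, symplecticForm (n + 2) v w =
        ∑ x, v (.inl x) * w (.inr x) - ∑ x, w (.inl x) * v (.inr x) := fun v w => by
      simp only [symplecticForm, Finset.sum_sub_distrib, mul_comm (w (.inl _))]
    exact (h _ _).trans ((congrArg₂ _ (sum_leviElementary _ _ hsum hjk v w)
      (sum_leviElementary _ _ hsum hjk w v)).trans (h v w).symm)
  | soEven =>
    exact splits_of_lines R (c := soEven) Sum.inl Sum.inr Sum.inl_injective Sum.inr_injective hsum
      (.inr 0) (.inr 0) rfl rfl rfl rfl (Or.inr rfl) (Or.inr rfl) rfl rfl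
      fun j k hjk => ⟨leviElementary_mem_ker_det _ _ hjk, fun v =>
        sum_leviElementary _ _ hsum hjk v v⟩
  | soOdd =>
    refine splits_of_lines R (c := soOdd) (Sum.inl ∘ Sum.inl) (Sum.inl ∘ Sum.inr)
      (Sum.inl_injective.comp Sum.inl_injective) (Sum.inl_injective.comp Sum.inr_injective)
      (fun x y => Sum.inl_injective.ne (hsum x y))
      (.inl (.inr 0)) (.inl (.inr 0)) rfl rfl rfl rfl (Or.inr rfl) (Or.inr rfl) rfl rfl
      fun j k hjk => ⟨leviElementary_mem_ker_det _ _ hjk, fun v =>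
        congrArg₂ (fun s t => s ^ 2 + t) ?_ (sum_leviElementary _ _
          (fun x y => Sum.inl_injective.ne (hsum x y)) hjk v v)⟩
    rw [leviElementary_apply _ _ fun x y => Sum.inl_injective.ne (hsum x y)]
    simp

/-! ### The double stabilization map -/

lemma reeder_reeder_eq_add {g h : c.Vec (n + 3) F ≃ₗ[F] c.Vec (n + 3) F}
    (hg : g ∈ group F c (n + 3)) (hh : h ∈ group F c (n + 3))
    (key : ∀ z : List (Submodule F (c.Vec (n + 1) F)) →₀ R,
      reederChain F R c (n + 2) (reederChain F R c (n + 1) z) =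
        vertexMap R (Submodule.map (g : c.Vec (n + 3) F →ₗ[F] c.Vec (n + 3) F))
          (reederChain F R c (n + 2) (reederChain F R c (n + 1) z)) +
        vertexMap R (Submodule.map (h : c.Vec (n + 3) F →ₗ[F] c.Vec (n + 3) F))
          (reederChain F R c (n + 2) (reederChain F R c (n + 1) z)))
    (a : Steinberg F R c (n + 1)) :
    reeder F R c (n + 1) (reeder F R c n a) =
      steinbergRep F R c (n + 3) ⟨g, hg⟩ (reeder F R c (n + 1) (reeder F R c n a)) +
      steinbergRep F R c (n + 3) ⟨h, hh⟩ (reeder F R c (n + 1) (reeder F R c n a)) := by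
  obtain ⟨_, z, hz, rfl⟩ := a
  apply Subtype.ext
  rw [Submodule.coe_add]
  have := congrArg (Submodule.mkQ (boundaries R (vertices F c (n + 3)) (c.rank (n + 3)))) (key z)
  rw [map_add] at this
  exact this

/-- The inclusion `G_{n+1} → G_{n+3}`. -/
noncomputable abbrev stabHom₂ (F : Type u) [Field F] (c : ClassicalFamily) (n : ℕ) :
    group F c (n + 1) →* group F c (n + 3) :=
  (stabHom F c (n + 2)).comp (stabHom F c (n + 1))

open CategoryTheory in
/-- The equivariant double suspension `St_{G_{n+1}} → St_{G_{n+3}}`. -/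
noncomputable def reederHom₂ (F : Type u) [Field F] (R : Type u) [CommRing R]
    (c : ClassicalFamily) (n : ℕ) : St F R c (n + 1) ⟶ Rep.res (stabHom₂ F c n) (St F R c (n + 3)) :=
  reederHom F R c n ≫ (Rep.resFunctor (stabHom F c (n + 1))).map (reederHom F R c (n + 1))

open CategoryTheory in
lemma stabilization_comp_stabilization (i n : ℕ) :
    stabilization F R c i n ≫ stabilization F R c i (n + 1) =
      groupHomology.map (stabHom₂ F c n) (reederHom₂ F R c n) i :=
  (groupHomology.map_comp (stabHom F c (n + 1)) (stabHom F c (n + 2)) (reederHom F R c n)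
    (reederHom F R c (n + 1)) i).symm

open CategoryTheory in
lemma stabilization_comp_stabilization_eq_zero (i n : ℕ) :
    stabilization F R c i n ≫ stabilization F R c i (n + 1) = 0 := by
  obtain ⟨g, h, hg, hh, hgc, hhc, key⟩ := splitsDoubleSuspension (F := F) R c (n + 1)
  rw [stabilization_comp_stabilization]
  exact groupHomology.map_eq_zero_of_eq_add_translates (stabHom₂ F c n) (reederHom₂ F R c n)
    ⟨g, hg⟩ ⟨h, hh⟩ (fun x => Subtype.ext (hgc x.1)) (fun x => Subtype.ext (hhc x.1))
    (reeder_reeder_eq_add R hg hh key) i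

end ClassicalFamily

/-- Surjectivity of the stabilization maps `H_i(G_{n-1}; St) → H_i(G_n; St)` for all `n ≥ N`, where
`N ≥ 2` and `n = m + 2`, implies that `H_i(G_n; St) = 0` for all `n ≥ N + 1`. -/
theorem lemma3p1 (c : ClassicalFamily) (F : Type u) [Field F] (R : Type u) [CommRing R]
    (i N : ℕ) (hN : 2 ≤ N)
    (hstab : ∀ m : ℕ, N ≤ m + 2 →
      Function.Surjective (ClassicalFamily.stabilization F R c i m).hom) :
    ∀ n : ℕ, N + 1 ≤ n →
      CategoryTheory.Limits.IsZero (groupHomology (ClassicalFamily.St F R c n) i) := by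
  intro n hn
  obtain ⟨m, rfl⟩ : ∃ m, n = m + 3 := ⟨n - 3, by omega⟩
  have hzero := ClassicalFamily.stabilization_comp_stabilization_eq_zero (F := F) R (c := c) i m
  have hsurj := (hstab (m + 1) (by omega)).comp (hstab m (by omega))
  rw [ModuleCat.isZero_iff_subsingleton]
  refine subsingleton_of_forall_eq 0 fun x => ?_
  obtain ⟨y, rfl⟩ := hsurj x
  exact LinearMap.congr_fun (congrArg ModuleCat.Hom.hom hzero) y
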